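/- **Lemma 4.3.** Let $N\in\mathbb N$, $T>0$, and for $i=1,\dots,N$ let $l_i>0$, $D_i>0$ and $Q_i=(0,l_i)\times(0,T)$. Put $\mathbb L^2=\prod_{i=1}^N L^2(0,l_i)$ with $\|\varphi\|_{\mathbb L^2}^2=\sum_i\|\varphi_i\|_{L^2}^2$ and inner product $(\cdot,\cdot)$, $\mathbb L^\infty=\prod_{i=1}^N L^\infty(Q_i)$ with $\|u\|_{\mathbb L^\infty}=\sum_i\|u_i\|_{L^\infty(Q_i)}$, and $$\mathbb V=\Big\{\varphi\in\prod_{i=1}^N H^1(0,l_i):\ \varphi_i(0)=\varphi_j(0),\ \varphi_i(l_i)=0\ \text{ for all } i,j\Big\},\qquad \|\varphi\|_{\mathbb V}^2=\|\varphi\|_{\mathbb L^2}^2+\|\partial_x\varphi\|_{\mathbb L^2}^2,$$ with dual $\mathbb V^\star$; $\mathbb V\hookrightarrow\mathbb L^2\hookrightarrow\mathbb V^\star$ through the inner product of $\mathbb L^2$. Let $$\mathbb W(0,T)=\{\rho\in L^2(0,T;\mathbb V):\ \rho_t\in L^2(0,T;\mathbb V^\star)\},\qquad \|\rho\|_{\mathbb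 W(0,T)}^2=\|\rho\|_{L^2(0,T;\mathbb V)}^2+\|\rho_t\|_{L^2(0,T;\mathbb V^\star)}^2,$$ where $\rho_t$ is the distributional time derivative. For $u\in\mathbb L^\infty$, a.e. $t\in(0,T)$ and $\rho,\varphi\in\mathbb V$ let $$\mathcal F[u(t)](\rho,\varphi)=\sum_{i=1}^N\int_0^{l_i}\Big(D_i\,\partial_x\rho_i(x)+u_i(x,t)\,\rho_i(x)\Big)\,\partial_x\varphi_i(x)\,dx ,$$ and for $\rho\in L^2(0,T;\mathbb V)$ let $\mathcal F[u](\rho,\cdot)$ denote the map $t\mapsto\mathcal F[u(t)](\rho(t),\cdot)\in\mathbb V^\star$. For $\rho\in\mathbb W(0,T)$ let $\rho(0)\in\mathbb L^2$ be the value at $t=0$ of the representative of $\rho$ in $C([0,T];\mathbb L^2)$. Let $\rho^0\in\mathbb L^2$. (1) Every $\rho\in\mathbb W(0,T)$ has a unique initial value $\rho(0)\in\mathbb L^2$, and for all $u\in\mathbb L^\infty$ and $\rho\in L^2(0,T;\mathbb V)$ the functional $\mathcal F[u](\rho,\cdot)$ is an element of $L^2(0,T;\mathbb V^\star)$; so the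 map $$\mathcal G:\ \mathbb W(0,T)\times\mathbb L^\infty\to L^2(0,T;\mathbb V^\star)\times\mathbb L^2,\qquad \mathcal G(\rho,u)=\big(\rho_t+\mathcal F[u](\rho,\cdot),\ \rho(0)-\rho^0\big)$$ is well defined. It is of class $C^\infty$ (in the sense of Fréchet). (2) For every $u\in\mathbb L^\infty$ there is a unique $\rho=:G(u)\in\mathbb W(0,T)$ which is a weak solution of the Fokker--Planck equation $\partial_t\rho_i-D_i\partial_x^2\rho_i-\partial_x(u_i\rho_i)=0$ on the star graph with initial value $\rho^0$, that is, $$\frac{d}{dt}(\rho(\cdot),\varphi)+\mathcal F[u(\cdot)](\rho(\cdot),\varphi)=0\ \text{ in }\mathcal D'(0,T)\ \text{ for all }\varphi\in\mathbb V,\qquad \rho(0)=\rho^0\ \text{ in }\mathbb L^2 .$$ The control-to-state map $G:\mathbb L^\infty\to\mathbb W(0,T)$ is of class $C^\infty$. -/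

import Mathlib

open MeasureTheory Set
open scoped ENNReal ContDiff

noncomputable section

namespace StarGraph

/-- `θ` is a smooth real function with compact support contained in the open interval `(a, b)`. -/
def IsTest (a b : ℝ) (θ : ℝ → ℝ) : Prop :=
  ContDiff ℝ ∞ θ ∧ HasCompactSupport θ ∧ tsupport θ ⊆ Ioo a b

theorem IsTest.memLp {a b : ℝ} {θ : ℝ → ℝ} (h : IsTest a b θ) (μ : Measure ℝ)
    [IsFiniteMeasureOnCompacts μ] : MemLp θ 2 μ :=
  h.1.continuous.memLp_of_hasCompactSupport h.2.1

theorem IsTest.memLp_deriv {a b : ℝ} {θ : ℝ → ℝ} (h : IsTest a b θ) (μ : Measure ℝ)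
    [IsFiniteMeasureOnCompacts μ] : MemLp (deriv θ) 2 μ :=
  (h.1.continuous_deriv (by simp)).memLp_of_hasCompactSupport h.2.1.deriv

/-- Lebesgue measure on the edge `(0, L)`, also used for the time interval `(0, T)`. -/
abbrev edge (L : ℝ) : Measure ℝ := volume.restrict (Ioo 0 L)

/-- The real Lebesgue space `L²(0, L)`. -/
abbrev L2 (L : ℝ) : Type := Lp ℝ 2 (edge L)

/-- `g` is the weak derivative of `f` on `(0, L)`. -/
def IsWeakDeriv (L : ℝ) (f g : L2 L) : Prop :=
  ∀ θ : ℝ → ℝ, IsTest 0 L θ →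
    ∫ x in Ioo 0 L, f x * deriv θ x = -∫ x in Ioo 0 L, g x * θ x

/-- `f` has a representative that is continuous on `[0, L]`, with value `a` at `0` and `b` at `L`.
For `f` in `H¹(0, L)` such `a` and `b` exist and are the traces of `f`. -/
def HasEndpointValues (L : ℝ) (f : L2 L) (a b : ℝ) : Prop :=
  ∃ F : ℝ → ℝ, ContinuousOn F (Icc 0 L) ∧ (∀ᵐ x ∂edge L, f x = F x) ∧ F 0 = a ∧ F L = b

theorem IsWeakDeriv.zero (L : ℝ) : IsWeakDeriv L 0 0 := by
  intro θ _
  have h : ∀ η : ℝ → ℝ, ∫ x in Ioo 0 L, (0 : L2 L) x * η x = 0 := by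
    intro η
    rw [integral_congr_ae (g := fun _ => (0 : ℝ)), integral_zero]
    filter_upwards [Lp.coeFn_zero ℝ 2 (edge L)] with x hx
    rw [hx, Pi.zero_apply, zero_mul]
  rw [h, h, neg_zero]

theorem IsWeakDeriv.add {L : ℝ} {f g f' g' : L2 L} (h : IsWeakDeriv L f g)
    (h' : IsWeakDeriv L f' g') : IsWeakDeriv L (f + f') (g + g') := by
  intro θ hθ
  have key : ∀ (p q : L2 L) (η : ℝ → ℝ), MemLp η 2 (edge L) →
      ∫ x in Ioo 0 L, (p + q) x * η x
        = (∫ x in Ioo 0 L, p x * η x) + ∫ x in Ioo 0 L, q x * η x := by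
    intro p q η hη
    refine (integral_congr_ae ?_).trans
      (integral_add ((Lp.memLp p).integrable_mul hη) ((Lp.memLp q).integrable_mul hη))
    filter_upwards [Lp.coeFn_add p q] with x hx
    rw [hx]
    exact add_mul _ _ _
  rw [key _ _ _ (hθ.memLp_deriv _), key _ _ _ (hθ.memLp _), h θ hθ, h' θ hθ]
  ring

theorem IsWeakDeriv.smul {L : ℝ} {f g : L2 L} (c : ℝ) (h : IsWeakDeriv L f g) :
    IsWeakDeriv L (c • f) (c • g) := by
  intro θ hθ
  have key : ∀ (p : L2 L) (η : ℝ → ℝ),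
      ∫ x in Ioo 0 L, (c • p) x * η x = c * ∫ x in Ioo 0 L, p x * η x := by
    intro p η
    rw [← integral_const_mul]
    refine integral_congr_ae ?_
    filter_upwards [Lp.coeFn_smul c p] with x hx
    rw [hx]
    exact mul_assoc _ _ _
  rw [key, key, h θ hθ, mul_neg]

theorem HasEndpointValues.zero (L : ℝ) : HasEndpointValues L 0 0 0 :=
  ⟨fun _ => 0, continuousOn_const, Lp.coeFn_zero ℝ 2 (edge L), rfl, rfl⟩

theorem HasEndpointValues.add {L : ℝ} {f g : L2 L} {a b a' b' : ℝ}
    (h : HasEndpointValues L f a b) (h' : HasEndpointValues L g a' b') :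
    HasEndpointValues L (f + g) (a + a') (b + b') := by
  obtain ⟨F, hF, hf, h0, h1⟩ := h
  obtain ⟨F', hF', hf', h0', h1'⟩ := h'
  refine ⟨fun x => F x + F' x, hF.add hF', ?_, by simp [h0, h0'], by simp [h1, h1']⟩
  filter_upwards [hf, hf', Lp.coeFn_add f g] with x e1 e2 e3
  rw [e3, Pi.add_apply, e1, e2]

theorem HasEndpointValues.smul {L : ℝ} {f : L2 L} {a b : ℝ} (c : ℝ)
    (h : HasEndpointValues L f a b) : HasEndpointValues L (c • f) (c * a) (c * b) := by
  obtain ⟨F, hF, hf, h0, h1⟩ := h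
  refine ⟨fun x => c * F x, continuousOn_const.mul hF, ?_, by simp [h0], by simp [h1]⟩
  filter_upwards [hf, Lp.coeFn_smul c f] with x e1 e2
  rw [e2, Pi.smul_apply, e1, smul_eq_mul]

variable {N : ℕ}

/-- `𝕃² = ∏ᵢ L²(0, lᵢ)` with its Hilbert norm. -/
abbrev LL2 (l : Fin N → ℝ) : Type := PiLp 2 (fun i => L2 (l i))

/-- `𝕃^∞ = ∏ᵢ L^∞(Qᵢ)`, `Qᵢ = (0, lᵢ) × (0, T)`, with the norm `∑ᵢ ‖uᵢ‖_{L^∞(Qᵢ)}`.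
Points of `Qᵢ` are written `(x, t)`. -/
abbrev LLinf (l : Fin N → ℝ) (T : ℝ) : Type :=
  PiLp 1 (fun i => Lp ℝ (⊤ : ℝ≥0∞) ((volume : Measure (ℝ × ℝ)).restrict (Ioo 0 (l i) ×ˢ Ioo 0 T)))

/-- The linear subspace of `𝕃² × 𝕃²` of the pairs `(φ, ∂ₓφ)` with `φ ∈ ∏ᵢ H¹(0, lᵢ)`,
`φᵢ(0) = φⱼ(0)` and `φᵢ(lᵢ) = 0`. -/
def VSub (l : Fin N → ℝ) : Submodule ℝ (WithLp 2 (LL2 l × LL2 l)) where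
  carrier := {φ | (∀ i, IsWeakDeriv (l i) (φ.fst i) (φ.snd i)) ∧
    ∃ c : ℝ, ∀ i, HasEndpointValues (l i) (φ.fst i) c 0}
  zero_mem' := ⟨fun i => IsWeakDeriv.zero (l i), 0, fun i => HasEndpointValues.zero (l i)⟩
  add_mem' := by
    rintro φ ψ ⟨h, c, hc⟩ ⟨h', c', hc'⟩
    refine ⟨fun i => (h i).add (h' i), c + c', fun i => ?_⟩
    have := (hc i).add (hc' i)
    rw [add_zero] at this
    exact this
  smul_mem' := by
    rintro r φ ⟨h, c, hc⟩
    refine ⟨fun i => (h i).smul r, r * c, fun i => ?_⟩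
    have := (hc i).smul r
    rw [mul_zero] at this
    exact this

/-- `𝕍`: the functions `φ ∈ ∏ᵢ H¹(0, lᵢ)` with `φᵢ(0) = φⱼ(0)` and `φᵢ(lᵢ) = 0`, with the inner
product and norm of `ℍ¹`, `‖φ‖² = ‖φ‖²_{𝕃²} + ‖∂ₓφ‖²_{𝕃²}`. An element is given by the pair of `φ`
and its (unique) weak derivative. -/
def V (l : Fin N → ℝ) : Type := VSub l

instance (l : Fin N → ℝ) : NormedAddCommGroup (V l) := inferInstanceAs (NormedAddCommGroup (VSub l))

instance (l : Fin N → ℝ) : InnerProductSpace ℝ (V l) :=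
  inferInstanceAs (InnerProductSpace ℝ (VSub l))

/-- The embedding `𝕍 ↪ 𝕃²`. -/
def V.val {l : Fin N → ℝ} : V l →L[ℝ] LL2 l :=
  (WithLp.fstL 2 ℝ (LL2 l) (LL2 l)).comp (VSub l).subtypeL

/-- The weak derivative `φ ↦ ∂ₓφ` from `𝕍` to `𝕃²`. -/
def V.dx {l : Fin N → ℝ} : V l →L[ℝ] LL2 l :=
  (WithLp.sndL 2 ℝ (LL2 l) (LL2 l)).comp (VSub l).subtypeL

/-- The dual space `𝕍*`. -/
abbrev VStar (l : Fin N → ℝ) : Type := StrongDual ℝ (V l)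

/-- `L²(0, T; 𝕍)`. -/
abbrev L2V (l : Fin N → ℝ) (T : ℝ) : Type := Lp (V l) 2 (edge T)

/-- `L²(0, T; 𝕍*)`. -/
abbrev L2VStar (l : Fin N → ℝ) (T : ℝ) : Type := Lp (VStar l) 2 (edge T)

/-- `σ ∈ L²(0, T; 𝕍*)` is the distributional time derivative of `ρ ∈ L²(0, T; 𝕍)`, where `𝕍` is
embedded in `𝕍*` through the inner product of `𝕃²`. -/
def IsTimeDeriv (l : Fin N → ℝ) (T : ℝ) (ρ : L2V l T) (σ : L2VStar l T) : Prop :=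
  ∀ θ : ℝ → ℝ, IsTest 0 T θ → ∀ φ : V l,
    ∫ t in Ioo 0 T, deriv θ t * inner ℝ (V.val (ρ t)) (V.val φ)
      = -∫ t in Ioo 0 T, θ t * σ t φ

theorem memLp_inner {l : Fin N → ℝ} {T : ℝ} (ρ : L2V l T) (φ : V l) :
    MemLp (fun t => inner ℝ (V.val (ρ t)) (V.val φ)) 2 (edge T) :=
  ((ContinuousLinearMap.flip (innerSL ℝ) (V.val φ)).comp V.val).comp_memLp' (Lp.memLp ρ)

theorem memLp_apply {l : Fin N → ℝ} {T : ℝ} (σ : L2VStar l T) (φ : V l) :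
    MemLp (fun t => σ t φ) 2 (edge T) :=
  (ContinuousLinearMap.flip (ContinuousLinearMap.id ℝ (VStar l)) φ).comp_memLp' (Lp.memLp σ)

theorem IsTimeDeriv.zero (l : Fin N → ℝ) (T : ℝ) : IsTimeDeriv l T 0 0 := by
  intro θ _ φ
  have e1 : ∫ t in Ioo 0 T, deriv θ t * inner ℝ (V.val ((0 : L2V l T) t)) (V.val φ) = 0 := by
    refine (integral_congr_ae ?_).trans (integral_zero ℝ ℝ)
    filter_upwards [Lp.coeFn_zero (V l) 2 (edge T)] with t ht
    rw [ht, Pi.zero_apply, map_zero, inner_zero_left, mul_zero]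
  have e2 : ∫ t in Ioo 0 T, θ t * (0 : L2VStar l T) t φ = 0 := by
    refine (integral_congr_ae ?_).trans (integral_zero ℝ ℝ)
    filter_upwards [Lp.coeFn_zero (VStar l) 2 (edge T)] with t ht
    rw [ht, Pi.zero_apply, zero_apply, mul_zero]
  rw [e1, e2, neg_zero]

theorem IsTimeDeriv.add {l : Fin N → ℝ} {T : ℝ} {ρ ρ' : L2V l T} {σ σ' : L2VStar l T}
    (h : IsTimeDeriv l T ρ σ) (h' : IsTimeDeriv l T ρ' σ') :
    IsTimeDeriv l T (ρ + ρ') (σ + σ') := by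
  intro θ hθ φ
  have e1 : ∫ t in Ioo 0 T, deriv θ t * inner ℝ (V.val ((ρ + ρ') t)) (V.val φ)
      = (∫ t in Ioo 0 T, deriv θ t * inner ℝ (V.val (ρ t)) (V.val φ))
        + ∫ t in Ioo 0 T, deriv θ t * inner ℝ (V.val (ρ' t)) (V.val φ) := by
    refine (integral_congr_ae ?_).trans
      (integral_add ((hθ.memLp_deriv _).integrable_mul (memLp_inner ρ φ))
        ((hθ.memLp_deriv _).integrable_mul (memLp_inner ρ' φ)))
    filter_upwards [Lp.coeFn_add ρ ρ'] with t ht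
    rw [ht, Pi.add_apply, map_add, inner_add_left]
    exact mul_add _ _ _
  have e2 : ∫ t in Ioo 0 T, θ t * (σ + σ') t φ
      = (∫ t in Ioo 0 T, θ t * σ t φ) + ∫ t in Ioo 0 T, θ t * σ' t φ := by
    refine (integral_congr_ae ?_).trans
      (integral_add ((hθ.memLp _).integrable_mul (memLp_apply σ φ))
        ((hθ.memLp _).integrable_mul (memLp_apply σ' φ)))
    filter_upwards [Lp.coeFn_add σ σ'] with t ht
    rw [ht, Pi.add_apply, add_apply]
    exact mul_add _ _ _
  rw [e1, e2, h θ hθ φ, h' θ hθ φ]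
  ring

theorem IsTimeDeriv.smul {l : Fin N → ℝ} {T : ℝ} {ρ : L2V l T} {σ : L2VStar l T} (c : ℝ)
    (h : IsTimeDeriv l T ρ σ) : IsTimeDeriv l T (c • ρ) (c • σ) := by
  intro θ hθ φ
  have e1 : ∫ t in Ioo 0 T, deriv θ t * inner ℝ (V.val ((c • ρ) t)) (V.val φ)
      = c * ∫ t in Ioo 0 T, deriv θ t * inner ℝ (V.val (ρ t)) (V.val φ) := by
    rw [← integral_const_mul]
    refine integral_congr_ae ?_
    filter_upwards [Lp.coeFn_smul c ρ] with t ht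
    rw [ht, Pi.smul_apply, map_smul, real_inner_smul_left, mul_left_comm]
  have e2 : ∫ t in Ioo 0 T, θ t * (c • σ) t φ = c * ∫ t in Ioo 0 T, θ t * σ t φ := by
    rw [← integral_const_mul]
    refine integral_congr_ae ?_
    filter_upwards [Lp.coeFn_smul c σ] with t ht
    rw [ht, Pi.smul_apply, smul_apply, smul_eq_mul, mul_left_comm]
  rw [e1, e2, h θ hθ φ, mul_neg]

/-- The linear subspace of `L²(0, T; 𝕍) × L²(0, T; 𝕍*)` of the pairs `(ρ, ρ_t)`. -/
def WSub (l : Fin N → ℝ) (T : ℝ) : Submodule ℝ (WithLp 2 (L2V l T × L2VStar l T)) where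
  carrier := {p | IsTimeDeriv l T p.fst p.snd}
  zero_mem' := IsTimeDeriv.zero l T
  add_mem' := fun hp hq => IsTimeDeriv.add hp hq
  smul_mem' := fun c _ hp => IsTimeDeriv.smul c hp

/-- `𝕎(0, T)`: the `ρ ∈ L²(0, T; 𝕍)` with `ρ_t ∈ L²(0, T; 𝕍*)`, with the norm
`(‖ρ‖² + ‖ρ_t‖²)^(1/2)`. An element is given by the pair of `ρ` and its (unique) time
derivative. -/
def W (l : Fin N → ℝ) (T : ℝ) : Type := WSub l T

instance (l : Fin N → ℝ) (T : ℝ) : NormedAddCommGroup (W l T) :=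
  inferInstanceAs (NormedAddCommGroup (WSub l T))

instance (l : Fin N → ℝ) (T : ℝ) : NormedSpace ℝ (W l T) :=
  inferInstanceAs (NormedSpace ℝ (WSub l T))

/-- The embedding `𝕎(0, T) ↪ L²(0, T; 𝕍)`. -/
def W.val {l : Fin N → ℝ} {T : ℝ} : W l T →L[ℝ] L2V l T :=
  (WithLp.fstL 2 ℝ (L2V l T) (L2VStar l T)).comp (WSub l T).subtypeL

/-- The time derivative `ρ ↦ ρ_t` from `𝕎(0, T)` to `L²(0, T; 𝕍*)`. -/
def W.dt {l : Fin N → ℝ} {T : ℝ} : W l T →L[ℝ] L2VStar l T :=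
  (WithLp.sndL 2 ℝ (L2V l T) (L2VStar l T)).comp (WSub l T).subtypeL

/-- The representative of `ρ` in `C([0, T]; 𝕃²)` exists and takes the value `h` at time `0`. -/
def HasInitialValue {l : Fin N → ℝ} {T : ℝ} (ρ : W l T) (h : LL2 l) : Prop :=
  ∃ c : ℝ → LL2 l, ContinuousOn c (Icc 0 T) ∧ (∀ᵐ t ∂edge T, V.val (W.val ρ t) = c t) ∧ c 0 = h

/-- `ρ(0) ∈ 𝕃²`: the unique `h` with `HasInitialValue ρ h`. -/
def initialValue {l : Fin N → ℝ} {T : ℝ} (ρ : W l T) : LL2 l :=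
  Classical.epsilon fun h => HasInitialValue ρ h

/-- `𝓕[u(t)](ρ, φ) = ∑ᵢ ∫₀^{lᵢ} (Dᵢ ∂ₓρᵢ + uᵢ(·, t) ρᵢ) ∂ₓφᵢ dx` for `ρ, φ ∈ 𝕍`. -/
def form (l D : Fin N → ℝ) {T : ℝ} (u : LLinf l T) (t : ℝ) (ρ φ : V l) : ℝ :=
  ∑ i, ∫ x in Ioo 0 (l i), (D i * V.dx ρ i x + u i (x, t) * V.val ρ i x) * V.dx φ i x

/-- `f ∈ L²(0, T; 𝕍*)` is the functional `𝓕[u](ρ, ·)`, that is `t ↦ 𝓕[u(t)](ρ(t), ·)`. -/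
def IsFormFunctional (l D : Fin N → ℝ) {T : ℝ} (u : LLinf l T) (ρ : L2V l T)
    (f : L2VStar l T) : Prop :=
  ∀ᵐ t ∂edge T, ∀ φ : V l, f t φ = form l D u t (ρ t) φ

/-- `𝓕[u](ρ, ·) ∈ L²(0, T; 𝕍*)`: the unique `f` with `IsFormFunctional l D u ρ f`. -/
def formFunctional (l D : Fin N → ℝ) {T : ℝ} (u : LLinf l T) (ρ : L2V l T) : L2VStar l T :=
  Classical.epsilon fun f => IsFormFunctional l D u ρ f

/-- The map `𝒢(ρ, u) = (ρ_t + 𝓕[u](ρ, ·), ρ(0) - ρ⁰)`. -/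
def stateMap (l D : Fin N → ℝ) (T : ℝ) (ρ0 : LL2 l) (p : W l T × LLinf l T) :
    L2VStar l T × LL2 l :=
  (W.dt p.1 + formFunctional l D p.2 (W.val p.1), initialValue p.1 - ρ0)

/-- `ρ ∈ 𝕎(0, T)` is the weak solution of the Fokker-Planck equation with drift `u`:
`d/dt (ρ(t), φ) + 𝓕[u(t)](ρ(t), φ) = 0` in `𝒟'(0, T)` for all `φ ∈ 𝕍`, and `ρ(0) = ρ⁰`. -/
def IsWeakSolution (l D : Fin N → ℝ) (T : ℝ) (ρ0 : LL2 l) (u : LLinf l T) (ρ : W l T) : Prop :=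
  (∀ φ : V l, ∀ θ : ℝ → ℝ, IsTest 0 T θ →
    -(∫ t in Ioo 0 T, deriv θ t * inner ℝ (V.val (W.val ρ t)) (V.val φ))
      + ∫ t in Ioo 0 T, θ t * form l D u t (W.val ρ t) φ = 0) ∧
  HasInitialValue ρ ρ0

/-- The control-to-state map `G : u ↦ ρ`, `ρ` the unique weak solution. -/
def controlToState (l D : Fin N → ℝ) (T : ℝ) (ρ0 : LL2 l) (u : LLinf l T) : W l T :=
  Classical.epsilon fun ρ => IsWeakSolution l D T ρ0 u ρ

end StarGraph

end

/-!
For a fixed drift `u` the map `ρ ↦ (ρ_t + 𝓕[u](ρ, ·), ρ(0))` is a bounded linear operator from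
`𝕎(0, T)` to `L²(0, T; 𝕍*) × 𝕃²`, and it depends on `u` in an affine and continuous way. This
makes `𝒢` smooth (`contDiff_stateMap`). If the operator is bijective for every `u`, then the
solution is its inverse applied to `(0, ρ⁰)`, and it is a smooth function of `u` because inversion
of operators between Banach spaces is smooth (`contDiff_of_bijective`). No implicit function
theorem and no explicit bound for the inverse are needed, only that `𝕎(0, T)` is complete and that
the linear parabolic problem is well posed for all data (`bijective_stateOp`).

Well-posedness is proved for an abstract Hilbert triple given by an injective bounded operator
`J : V → H` with dense range. The dual `V*` is identified with `V` by the Riesz isomorphism. The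
embedding `V → V*` then becomes the Gram operator `B = J†J`, and `s` is the time derivative of `ρ`
when `Bρ` is a primitive of `s` (the du Bois-Reymond lemma `exists_ae_eq_primitive` shows that
this is the distributional time derivative).

* Traces and the energy identity (`exists_continuous_representative`). If `(Bρ)' = s`, then
  `(B + ε)⁻¹Bρ` is absolutely continuous with values in `V`, so that its energy can be
  differentiated by the product rule. As `ε → 0` these functions converge to `ρ` in
  `L²(0, T; V)` and are Cauchy in `C([0, T]; H)`. This regularises in space rather than in time, so that no extension of `ρ`
  beyond `(0, T)` and no mollification is needed.
* Uniqueness and the a priori estimate (`exists_apriori_bound`) follow from the energy identity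
  with the weight `exp (-2βt)`, where `β` is the constant of the lower order term in Gårding's
  inequality.
* Existence (`exists_parabolic_solution`). The set of data that admit a solution is closed by the
  a priori estimate, and dense because an element orthogonal to it solves the adjoint problem
  backwards in time with homogeneous data, hence vanishes by the energy identity.

For the star graph, `𝕍` is complete because the traces of `H¹` functions are given by
`L²`-continuous expressions in `φ` and `∂ₓφ` (`mem_VSub_iff`), and the functional `𝓕[u](ρ, ·)` is
strongly measurable in time by Pettis' theorem (`stronglyMeasurable_dual`).
-/

noncomputable section

namespace StarGraph

/-! ### Primitives, test functions and the du Bois-Reymond lemma -/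

section Calculus

variable {E F G : Type*} [NormedAddCommGroup E] [NormedAddCommGroup F] [NormedAddCommGroup G]

theorem intervalIntegrable_of_edge {T : ℝ} {f : ℝ → E} (hf : Integrable f (edge T))
    {a b : ℝ} (ha : a ∈ Icc 0 T) (hb : b ∈ Icc 0 T) : IntervalIntegrable f volume a b := by
  have h : IntegrableOn f (Icc 0 T) volume := by
    rw [integrableOn_Icc_iff_integrableOn_Ioo]; exact hf
  rw [intervalIntegrable_iff]
  exact h.mono_set (uIoc_subset_uIcc.trans (uIcc_subset_Icc ha hb))

theorem integrable_edge_of_continuousOn {T : ℝ} {f : ℝ → E} (hf : ContinuousOn f (Icc 0 T)) :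
    Integrable f (edge T) :=
  (hf.integrableOn_Icc (μ := volume)).mono_set Ioo_subset_Icc_self

theorem exists_bound_of_continuousOn {T : ℝ} {f : ℝ → E} (hf : ContinuousOn f (Icc 0 T)) :
    ∃ C, 0 ≤ C ∧ ∀ t ∈ Icc 0 T, ‖f t‖ ≤ C := by
  obtain ⟨C, hC⟩ := isCompact_Icc.exists_bound_of_continuousOn hf
  exact ⟨max C 0, le_max_right _ _, fun t ht => (hC t ht).trans (le_max_left _ _)⟩

theorem memLp_edge_of_continuousOn {T : ℝ} {f : ℝ → E} (hf : ContinuousOn f (Icc 0 T))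
    (p : ℝ≥0∞) : MemLp f p (edge T) := by
  obtain ⟨C, -, hC⟩ := exists_bound_of_continuousOn hf
  refine MemLp.of_bound (integrable_edge_of_continuousOn hf).1 C ?_
  exact ae_restrict_of_forall_mem measurableSet_Ioo fun t ht => hC t (Ioo_subset_Icc_self ht)

/-- Functions continuous on `[0, T]` that agree almost everywhere agree on `[0, T]`. -/
theorem eqOn_Icc_of_ae_eq {T : ℝ} (hT : 0 < T) {f g : ℝ → E} (hf : ContinuousOn f (Icc 0 T))
    (hg : ContinuousOn g (Icc 0 T)) (h : ∀ᵐ t ∂edge T, f t = g t) : EqOn f g (Icc 0 T) := by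
  have h1 : EqOn f g (Ioo 0 T) :=
    Measure.eqOn_Ioo_of_ae_eq (μ := volume) h (hf.mono Ioo_subset_Icc_self)
      (hg.mono Ioo_subset_Icc_self)
  refine h1.of_subset_closure hf hg Ioo_subset_Icc_self ?_
  rw [closure_Ioo hT.ne]

variable [NormedSpace ℝ E] [NormedSpace ℝ F] [NormedSpace ℝ G]

theorem integral_edge {T : ℝ} (hT : 0 ≤ T) (f : ℝ → E) :
    ∫ t, f t ∂edge T = ∫ t in (0 : ℝ)..T, f t := by
  rw [intervalIntegral.integral_of_le hT, integral_Ioc_eq_integral_Ioo]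

theorem integral_indicator_edge {T t : ℝ} (ht : t ∈ Ioo 0 T) {s : Set ℝ} (hs : MeasurableSet s)
    (hst : (Ioo 0 T ∩ s : Set ℝ) =ᵐ[volume] Ioc 0 t) (q : ℝ → E) :
    ∫ r, s.indicator q r ∂edge T = ∫ r in (0 : ℝ)..t, q r := by
  rw [integral_indicator hs, Measure.restrict_restrict hs, inter_comm,
    setIntegral_congr_set hst, intervalIntegral.integral_of_le ht.1.le]

theorem continuousOn_primitive {T : ℝ} {f : ℝ → E} (hf : Integrable f (edge T)) :
    ContinuousOn (fun t => ∫ τ in (0 : ℝ)..t, f τ) (Icc 0 T) := by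
  have h : IntegrableOn f (Icc 0 T) volume := by
    rw [integrableOn_Icc_iff_integrableOn_Ioo]; exact hf
  exact (intervalIntegral.continuousOn_primitive h).congr fun t ht => by
    rw [intervalIntegral.integral_of_le ht.1]

theorem integrable_bilin_left {T : ℝ} (β : E →L[ℝ] F →L[ℝ] G) {f : ℝ → E} {Y : ℝ → F}
    (hf : Integrable f (edge T)) (hY : ContinuousOn Y (Icc 0 T)) :
    Integrable (fun τ => β (f τ) (Y τ)) (edge T) := by
  obtain ⟨C, hC0, hC⟩ := exists_bound_of_continuousOn hY
  refine ((hf.norm.const_mul ‖β‖).mul_const C).mono'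
    (β.aestronglyMeasurable_comp₂ hf.1 (integrable_edge_of_continuousOn hY).1) ?_
  refine ae_restrict_of_forall_mem measurableSet_Ioo fun t ht => ?_
  refine (β.le_opNorm₂ _ _).trans ?_
  have := hC t (Ioo_subset_Icc_self ht)
  gcongr

theorem integrable_bilin_right {T : ℝ} (β : E →L[ℝ] F →L[ℝ] G) {X : ℝ → E} {g : ℝ → F}
    (hX : ContinuousOn X (Icc 0 T)) (hg : Integrable g (edge T)) :
    Integrable (fun τ => β (X τ) (g τ)) (edge T) :=
  integrable_bilin_left β.flip hg hX

theorem setIntegral_eq_of_tsupport {T : ℝ} {θ : ℝ → ℝ} (h : tsupport θ ⊆ Ioo 0 T) (U : ℝ → E) :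
    ∫ t in Ioo 0 T, θ t • U t = ∫ t, θ t • U t := by
  refine setIntegral_eq_integral_of_forall_compl_eq_zero fun t ht => ?_
  rw [image_eq_zero_of_notMem_tsupport fun h' => ht (h h'), zero_smul]

variable [CompleteSpace E] [CompleteSpace F] [CompleteSpace G]

/-- Product rule for two primitives vanishing at `0`, by Fubini on the two triangles of
`(0, T)²`. -/
theorem bilin_integral_integral {T : ℝ} (hT : 0 ≤ T) (β : E →L[ℝ] F →L[ℝ] G)
    {f : ℝ → E} {g : ℝ → F} (hf : Integrable f (edge T)) (hg : Integrable g (edge T)) :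
    β (∫ τ in (0 : ℝ)..T, f τ) (∫ τ in (0 : ℝ)..T, g τ)
      = (∫ τ, β (f τ) (∫ r in (0 : ℝ)..τ, g r) ∂edge T)
        + ∫ τ, β (∫ r in (0 : ℝ)..τ, f r) (g τ) ∂edge T := by
  have hk : Integrable (fun z : ℝ × ℝ => β (f z.1) (g z.2)) ((edge T).prod (edge T)) :=
    hf.op_fst_snd β.continuous₂ ⟨‖β‖, fun x y => β.le_opNorm₂ x y⟩ hg
  set D : Set (ℝ × ℝ) := {p | p.2 ≤ p.1} with hD
  have hDm : MeasurableSet D := measurableSet_le measurable_snd measurable_fst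
  rw [← integral_edge hT, ← integral_edge hT, ← integral_prod_bilin β hf hg,
    ← integral_add_compl hDm hk, ← integral_indicator hDm, ← integral_indicator hDm.compl,
    integral_prod _ (hk.indicator hDm), integral_prod_symm _ (hk.indicator hDm.compl)]
  congr 1
  · refine setIntegral_congr_fun measurableSet_Ioo fun t ht => ?_
    have e : ∀ r, D.indicator (fun z : ℝ × ℝ => β (f z.1) (g z.2)) (t, r)
        = β (f t) ((Iic t).indicator g r) := by
      intro r
      by_cases h : r ≤ t <;> simp [indicator, hD, h]
    have hgi : Integrable ((Iic t).indicator g) (edge T) := hg.indicator measurableSet_Iic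
    simp only [e]
    rw [ContinuousLinearMap.integral_comp_comm _ hgi, integral_indicator_edge ht measurableSet_Iic]
    refine Filter.EventuallyEq.of_eq (Set.ext fun r => ?_)
    simp only [mem_inter_iff, mem_Ioo, mem_Iic, mem_Ioc]
    exact ⟨fun h => ⟨h.1.1, h.2⟩, fun h => ⟨⟨h.1, h.2.trans_lt ht.2⟩, h.2⟩⟩
  · refine setIntegral_congr_fun measurableSet_Ioo fun t ht => ?_
    have e : ∀ r, Dᶜ.indicator (fun z : ℝ × ℝ => β (f z.1) (g z.2)) (r, t)
        = β.flip (g t) ((Iio t).indicator f r) := by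
      intro r
      by_cases h : t ≤ r <;> simp [indicator, hD, h, not_lt.2, not_le.1]
    have hfi : Integrable ((Iio t).indicator f) (edge T) := hf.indicator measurableSet_Iio
    simp only [e]
    rw [ContinuousLinearMap.integral_comp_comm _ hfi, integral_indicator_edge ht measurableSet_Iio]
    · rfl
    have : Ioo 0 T ∩ Iio t = Ioo 0 t := by
      ext r
      simp only [mem_inter_iff, mem_Ioo, mem_Iio]
      exact ⟨fun h => ⟨h.1.1, h.2⟩, fun h => ⟨⟨h.1, h.2.trans ht.2⟩, h.2⟩⟩
    rw [this]
    exact Ioo_ae_eq_Ioc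

/-- Product rule for absolutely continuous functions under a bounded bilinear map. -/
theorem bilin_primitive {T : ℝ} (hT : 0 ≤ T) (β : E →L[ℝ] F →L[ℝ] G) {X f : ℝ → E} {Y g : ℝ → F}
    (hf : Integrable f (edge T)) (hg : Integrable g (edge T))
    (hX : ∀ t ∈ Icc 0 T, X t = X 0 + ∫ τ in (0 : ℝ)..t, f τ)
    (hY : ∀ t ∈ Icc 0 T, Y t = Y 0 + ∫ τ in (0 : ℝ)..t, g τ) :
    β (X T) (Y T) = β (X 0) (Y 0) + ∫ τ, (β (f τ) (Y τ) + β (X τ) (g τ)) ∂edge T := by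
  have hfp := continuousOn_primitive hf
  have hgp := continuousOn_primitive hg
  have e : ∫ τ, (β (f τ) (Y τ) + β (X τ) (g τ)) ∂edge T
      = ∫ τ, ((β (f τ) (Y 0) + β (X 0) (g τ)) + (β (f τ) (∫ r in (0 : ℝ)..τ, g r)
        + β (∫ r in (0 : ℝ)..τ, f r) (g τ))) ∂edge T := by
    refine setIntegral_congr_fun measurableSet_Ioo fun t ht => ?_
    have ht' := Ioo_subset_Icc_self ht

    rw [hX t ht', hY t ht']
    simp only [map_add, add_apply]
    abel
  have i1 : Integrable (fun τ => β (f τ) (Y 0)) (edge T) :=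
    integrable_bilin_left β hf continuousOn_const
  have i2 : Integrable (fun τ => β (X 0) (g τ)) (edge T) :=
    integrable_bilin_right β continuousOn_const hg
  have i3 := integrable_bilin_left β hf hgp
  have i4 := integrable_bilin_right β hfp hg
  have e1 : ∫ τ, β (f τ) (Y 0) ∂edge T = β (∫ τ in (0 : ℝ)..T, f τ) (Y 0) := by
    rw [← integral_edge hT]
    exact (β.flip (Y 0)).integral_comp_comm hf
  have e2 : ∫ τ, β (X 0) (g τ) ∂edge T = β (X 0) (∫ τ in (0 : ℝ)..T, g τ) := by
    rw [← integral_edge hT]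
    exact (β (X 0)).integral_comp_comm hg
  rw [e, integral_add (by exact i1.add i2) (by exact i3.add i4), integral_add i1 i2,
    integral_add i3 i4, ← bilin_integral_integral hT β hf hg, e1, e2, hX T ⟨hT, le_rfl⟩,
    hY T ⟨hT, le_rfl⟩]
  simp only [map_add, add_apply]
  abel

theorem eq_primitive_deriv {m : ℝ → ℝ} (hm : ContDiff ℝ 1 m) (t : ℝ) :
    m t = m 0 + ∫ τ in (0 : ℝ)..t, deriv m τ := by
  rw [intervalIntegral.integral_deriv_eq_sub
    (fun x _ => (hm.differentiable (by simp)).differentiableAt)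
    ((hm.continuous_deriv (by simp)).intervalIntegrable _ _)]
  ring

/-- Integration by parts of a primitive against a `C¹` function. -/
theorem integral_deriv_smul_add {T : ℝ} (hT : 0 ≤ T) {m : ℝ → ℝ} (hm : ContDiff ℝ 1 m)
    {Y g : ℝ → E} (hg : Integrable g (edge T))
    (hY : ∀ t ∈ Icc 0 T, Y t = Y 0 + ∫ τ in (0 : ℝ)..t, g τ) :
    m T • Y T = m 0 • Y 0 + ∫ τ, (deriv m τ • Y τ + m τ • g τ) ∂edge T :=
  bilin_primitive hT (ContinuousLinearMap.lsmul ℝ ℝ)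
    (integrable_edge_of_continuousOn (hm.continuous_deriv (by simp)).continuousOn) hg
    (fun t _ => eq_primitive_deriv hm t) hY

theorem IsTest.integral_deriv_smul {T : ℝ} (hT : 0 ≤ T) {θ : ℝ → ℝ} (hθ : IsTest 0 T θ)
    {Y g : ℝ → E} (hg : Integrable g (edge T))
    (hY : ∀ t ∈ Icc 0 T, Y t = Y 0 + ∫ τ in (0 : ℝ)..t, g τ) :
    ∫ t in Ioo 0 T, deriv θ t • Y t = -∫ t in Ioo 0 T, θ t • g t := by
  have h0 : θ 0 = 0 := image_eq_zero_of_notMem_tsupport fun h => (hθ.2.2 h).1.ne rfl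
  have h1 : θ T = 0 := image_eq_zero_of_notMem_tsupport fun h => (hθ.2.2 h).2.ne rfl
  have hc : ContDiff ℝ 1 θ := hθ.1.of_le (by simp)
  have hYc : ContinuousOn Y (Icc 0 T) :=
    (continuousOn_const.add (continuousOn_primitive hg)).congr hY
  have h := integral_deriv_smul_add hT hc hg hY
  rw [h0, h1, zero_smul, zero_smul, zero_add, integral_add] at h
  · exact eq_neg_of_add_eq_zero_left h.symm
  · exact integrable_edge_of_continuousOn
      ((hc.continuous_deriv (by simp)).continuousOn.smul hYc)
  · exact integrable_bilin_right (ContinuousLinearMap.lsmul ℝ ℝ) hc.continuous.continuousOn hg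

/-- The primitive of a test function with mean zero is a test function. -/
theorem IsTest.primitive {T : ℝ} {θ : ℝ → ℝ} (hθ : IsTest 0 T θ)
    (h0 : ∫ t, θ t = 0) : IsTest 0 T (fun x => ∫ t in (0 : ℝ)..x, θ t) := by
  obtain ⟨hs, hc, hsub⟩ := hθ
  obtain ⟨α, β, hα, hβ, hK⟩ : ∃ α β, 0 < α ∧ β < T ∧ tsupport θ ⊆ Icc α β := by
    rcases (tsupport θ).eq_empty_or_nonempty with h | h
    · exact ⟨1, T - 1, one_pos, by linarith, by simp [h]⟩
    · obtain ⟨a, ha⟩ := hc.isCompact.exists_isLeast h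
      obtain ⟨b, hb⟩ := hc.isCompact.exists_isGreatest h
      exact ⟨a, b, (hsub ha.1).1, (hsub hb.1).2, fun x hx => ⟨ha.2 hx, hb.2 hx⟩⟩
  have hz : ∀ x, x ∉ Icc α β → θ x = 0 := fun x hx =>
    image_eq_zero_of_notMem_tsupport fun h => hx (hK h)
  have hzero : ∀ x, x ∉ Icc α β → ∫ t in (0 : ℝ)..x, θ t = 0 := by
    intro x hx
    by_cases hxa : x < α
    · refine (intervalIntegral.integral_congr fun t ht => hz t fun h => ?_).trans
        intervalIntegral.integral_zero
      have : t ≤ max 0 x := ht.2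
      exact absurd (h.1.trans this) (not_le.2 (max_lt hα hxa))
    · have hxb : β < x := by
        by_contra h
        exact hx ⟨not_lt.1 hxa, not_lt.1 h⟩
      rw [intervalIntegral.integral_eq_integral_of_support_subset, h0]
      intro t ht
      have := hK (subset_tsupport _ ht)
      exact ⟨hα.trans_le this.1, this.2.trans hxb.le⟩
  have hd : ∀ x, HasDerivAt (fun x => ∫ t in (0 : ℝ)..x, θ t) (θ x) x := fun x =>
    intervalIntegral.integral_hasDerivAt_right (hs.continuous.intervalIntegrable _ _)
      hs.continuous.stronglyMeasurable.stronglyMeasurableAtFilter hs.continuous.continuousAt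
  have hts : tsupport (fun x => ∫ t in (0 : ℝ)..x, θ t) ⊆ Icc α β :=
    closure_minimal (fun x hx => by
      by_contra h
      exact hx (hzero x h)) isClosed_Icc
  refine ⟨?_, ?_, fun x hx => ⟨hα.trans_le (hts hx).1, (hts hx).2.trans_lt hβ⟩⟩
  · rw [contDiff_infty_iff_deriv]
    refine ⟨fun x => (hd x).differentiableAt, ?_⟩
    rwa [show deriv (fun x => ∫ t in (0 : ℝ)..x, θ t) = θ from funext fun x => (hd x).deriv]
  · exact isCompact_Icc.of_isClosed_subset (isClosed_tsupport _) hts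

theorem exists_isTest_integral_eq_one {T : ℝ} (hT : 0 < T) :
    ∃ η, IsTest 0 T η ∧ ∫ t, η t = 1 := by
  let b : ContDiffBump (T / 2) := ⟨T / 8, T / 4, by positivity, by linarith⟩
  refine ⟨b.normed volume, ⟨b.contDiff_normed, b.hasCompactSupport_normed, ?_⟩, b.integral_normed⟩
  rw [b.tsupport_normed_eq, Real.closedBall_eq_Icc]
  intro x hx
  have h1 : T / 2 - T / 4 ≤ x := hx.1
  have h2 : x ≤ T / 2 + T / 4 := hx.2
  exact ⟨by linarith, by linarith⟩

/-- Fundamental lemma of the calculus of variations on `(0, T)`. -/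
theorem ae_eq_zero_of_forall_isTest {T : ℝ} {U : ℝ → E} (hU : Integrable U (edge T))
    (h : ∀ θ, IsTest 0 T θ → ∫ t in Ioo 0 T, θ t • U t = 0) : ∀ᵐ t ∂edge T, U t = 0 := by
  rw [ae_restrict_iff' measurableSet_Ioo]
  refine isOpen_Ioo.ae_eq_zero_of_integral_contDiff_smul_eq_zero
    (IntegrableOn.locallyIntegrableOn hU) fun θ h1 h2 h3 => ?_
  rw [← setIntegral_eq_of_tsupport h3]
  exact h θ ⟨h1, h2, h3⟩

/-- Du Bois-Reymond lemma: a function whose distributional derivative vanishes is constant. -/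
theorem exists_ae_eq_const {T : ℝ} (hT : 0 < T) {U : ℝ → E} (hU : Integrable U (edge T))
    (h : ∀ θ, IsTest 0 T θ → ∫ t in Ioo 0 T, deriv θ t • U t = 0) :
    ∃ c, ∀ᵐ t ∂edge T, U t = c := by
  obtain ⟨η, hη, hη1⟩ := exists_isTest_integral_eq_one hT
  have hint : ∀ {θ : ℝ → ℝ}, IsTest 0 T θ → Integrable (fun t => θ t • U t) (edge T) :=
    fun hθ => integrable_bilin_right (ContinuousLinearMap.lsmul ℝ ℝ)
      hθ.1.continuous.continuousOn hU
  refine ⟨∫ t in Ioo 0 T, η t • U t, ?_⟩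
  set c := ∫ t in Ioo 0 T, η t • U t with hc
  suffices H : ∀ᵐ t ∂edge T, U t - c = 0 by
    filter_upwards [H] with t ht using sub_eq_zero.1 ht
  refine ae_eq_zero_of_forall_isTest (hU.sub (integrable_const c)) fun θ hθ => ?_
  set m := ∫ t, θ t with hm
  have hθi : Integrable θ volume := hθ.1.continuous.integrable_of_hasCompactSupport hθ.2.1
  have hηi : Integrable η volume := hη.1.continuous.integrable_of_hasCompactSupport hη.2.1
  -- `θ - (∫ θ) η` has mean zero, hence is the derivative of a test function
  have hζ : IsTest 0 T (fun t => θ t - m * η t) := by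
    have hs : tsupport (fun t => θ t - m * η t) ⊆ tsupport θ ∪ tsupport η := by
      refine closure_minimal (fun x hx => ?_) ((isClosed_tsupport _).union (isClosed_tsupport _))
      by_contra hn
      simp only [mem_union, not_or] at hn
      refine hx ?_
      simp [image_eq_zero_of_notMem_tsupport hn.1, image_eq_zero_of_notMem_tsupport hn.2]
    refine ⟨hθ.1.sub (contDiff_const.mul hη.1), ?_, hs.trans (union_subset hθ.2.2 hη.2.2)⟩
    exact (hθ.2.1.isCompact.union hη.2.1.isCompact).of_isClosed_subset (isClosed_tsupport _) hs
  have hζ0 : ∫ t, (θ t - m * η t) = 0 := by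
    rw [integral_sub hθi (hηi.const_mul m), integral_const_mul, hη1, mul_one, sub_self]
  have hd : deriv (fun x => ∫ t in (0 : ℝ)..x, (θ t - m * η t)) = fun t => θ t - m * η t :=
    funext fun x => (intervalIntegral.integral_hasDerivAt_right
      (hζ.1.continuous.intervalIntegrable _ _)
      hζ.1.continuous.stronglyMeasurable.stronglyMeasurableAtFilter
      hζ.1.continuous.continuousAt).deriv
  have h1 := h _ (hζ.primitive hζ0)
  rw [hd] at h1
  simp only [sub_smul, mul_smul] at h1
  rw [integral_sub (hint hθ) (by exact (hint hη).smul m), integral_smul, ← hc] at h1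
  have h2 : ∫ t in Ioo 0 T, θ t • c = m • c := by
    rw [setIntegral_eq_of_tsupport hθ.2.2, integral_smul_const]
  simp only [smul_sub]
  rw [integral_sub (hint hθ) (hθi.restrict.smul_const c), h2, h1]

/-- A function with an integrable distributional derivative is a primitive of it. -/
theorem exists_ae_eq_primitive {T : ℝ} (hT : 0 < T) {U s : ℝ → E} (hU : Integrable U (edge T))
    (hs : Integrable s (edge T))
    (h : ∀ θ, IsTest 0 T θ →
      ∫ t in Ioo 0 T, deriv θ t • U t = -∫ t in Ioo 0 T, θ t • s t) :
    ∃ a, ∀ᵐ t ∂edge T, U t = a + ∫ τ in (0 : ℝ)..t, s τ := by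
  have hp := continuousOn_primitive hs
  have hpi := integrable_edge_of_continuousOn hp
  obtain ⟨c, hc⟩ := exists_ae_eq_const hT (hU.sub hpi) fun θ hθ => by
    have hθ' : ContinuousOn (deriv θ) (Icc 0 T) := (hθ.1.continuous_deriv (by simp)).continuousOn
    have h1 := hθ.integral_deriv_smul hT.le hs (Y := fun t => ∫ τ in (0 : ℝ)..t, s τ)
      (fun t _ => by simp)
    simp only [Pi.sub_apply, smul_sub]
    rw [integral_sub, h θ hθ, h1, sub_self]
    · exact integrable_bilin_right (ContinuousLinearMap.lsmul ℝ ℝ) hθ' hU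
    · exact integrable_bilin_right (ContinuousLinearMap.lsmul ℝ ℝ) hθ' hpi
  refine ⟨c, ?_⟩
  filter_upwards [hc] with t ht
  rw [← ht]
  simp

end Calculus

/-! ### The energy identity for a Hilbert triple -/

section Energy

open Filter Topology

variable {V H : Type*} [NormedAddCommGroup V] [InnerProductSpace ℝ V] [CompleteSpace V]
  [NormedAddCommGroup H] [InnerProductSpace ℝ H] [CompleteSpace H]

/-- The Gram operator `J†J` of `J : V → H`: the map `V → V*` induced by the inner product of `H`,
read in `V` through the Riesz isomorphism. -/
def gram (J : V →L[ℝ] H) : V →L[ℝ] V := J.adjoint ∘L J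

theorem gram_apply (J : V →L[ℝ] H) (v : V) : gram J v = J.adjoint (J v) := rfl

theorem inner_gram_right (J : V →L[ℝ] H) (v w : V) :
    inner ℝ v (gram J w) = inner ℝ (J v) (J w) := by
  rw [gram_apply, ContinuousLinearMap.adjoint_inner_right]

theorem inner_gram_left (J : V →L[ℝ] H) (v w : V) :
    inner ℝ (gram J v) w = inner ℝ (J v) (J w) := by
  rw [gram_apply, ContinuousLinearMap.adjoint_inner_left]

theorem adjoint_injective_of_denseRange {J : V →L[ℝ] H} (hJ : DenseRange J) :
    Function.Injective J.adjoint := by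
  rw [injective_iff_map_eq_zero]
  intro h hh
  refine hJ.eq_zero_of_inner_left ℝ fun v => ?_
  rw [← ContinuousLinearMap.adjoint_inner_left, hh, inner_zero_left]

/-- Yosida regularisation of the inverse of the Gram operator `B`: with
`R = (B + ε)⁻¹` and `e = εR`, `ε = 1 / (n + 1)`, one has `B R = R B = 1 - e`, and the contractions
`e` tend to `0` strongly because `B` is injective. -/
theorem exists_yosida (J : V →L[ℝ] H) (hJ : Function.Injective J) :
    ∃ R e : ℕ → V →L[ℝ] V, (∀ n v, gram J (R n v) = v - e n v) ∧
      (∀ n v, R n (gram J v) = v - e n v) ∧ (∀ n v, ‖e n v‖ ≤ ‖v‖) ∧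
      ∀ v, Tendsto (fun n => e n v) atTop (𝓝 0) := by
  set ε : ℕ → ℝ := fun n => 1 / ((n : ℝ) + 1) with hε
  have hε0 : ∀ n, 0 < ε n := fun n => Nat.one_div_pos_of_nat
  set S : ℕ → V →L[ℝ] V := fun n => gram J + ε n • 1 with hS
  have hSv : ∀ n v, S n v = gram J v + ε n • v := fun n v => rfl
  have hSin : ∀ n v, ε n * ‖v‖ ^ 2 ≤ inner ℝ (S n v) v := fun n v => by
    rw [hSv, inner_add_left, inner_gram_left, real_inner_smul_left, real_inner_self_eq_norm_sq,
      real_inner_self_eq_norm_sq]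
    nlinarith [sq_nonneg ‖J v‖]
  have hU : ∀ n, IsUnit (S n) := fun n =>
    ContinuousLinearMap.isUnit_of_forall_le_norm_inner_map (S n)
      (c := ⟨ε n, (hε0 n).le⟩) (hε0 n) fun v => by
        have := hSin n v
        rw [Real.norm_eq_abs]
        refine le_trans ?_ (le_abs_self _)
        rw [mul_comm]
        exact this
  set R : ℕ → V →L[ℝ] V := fun n => Ring.inverse (S n) with hR
  have hSR : ∀ n v, gram J (R n v) + ε n • R n v = v := fun n v => by
    have := congrArg (fun f : V →L[ℝ] V => f v) (Ring.mul_inverse_cancel (S n) (hU n))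
    exact this
  have hRS : ∀ n v, R n (gram J v) + ε n • R n v = v := fun n v => by
    have := congrArg (fun f : V →L[ℝ] V => f v) (Ring.inverse_mul_cancel (S n) (hU n))
    rw [← map_smul, ← map_add]
    exact this
  have hcontr : ∀ n v, ‖(ε n • R n) v‖ ≤ ‖v‖ := fun n v => by
    have h1 := hSin n (R n v)
    rw [hSv, hSR] at h1
    have h2 := real_inner_le_norm v (R n v)
    rw [smul_apply, norm_smul, Real.norm_of_nonneg (hε0 n).le]
    rcases (norm_nonneg (R n v)).eq_or_lt with h | h
    · rw [← h, mul_zero]; exact norm_nonneg _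
    · refine le_of_mul_le_mul_right ?_ h
      nlinarith
  refine ⟨R, fun n => ε n • R n, fun n v => eq_sub_of_add_eq (hSR n v),
    fun n v => eq_sub_of_add_eq (hRS n v), hcontr, ?_⟩
  have hε1 : Tendsto ε atTop (𝓝 0) := tendsto_one_div_add_atTop_nhds_zero_nat
  -- on the dense range of `B` one has `‖e (B w)‖ ≤ 2 ε ‖w‖`
  have hran : ∀ w, Tendsto (fun n => (ε n • R n) (gram J w)) atTop (𝓝 0) := fun w => by
    refine squeeze_zero_norm (a := fun n => ε n * (2 * ‖w‖)) (fun n => ?_)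
      (by simpa using hε1.mul_const (2 * ‖w‖))
    rw [smul_apply, norm_smul, Real.norm_of_nonneg (hε0 n).le,
      eq_sub_of_add_eq (hRS n w)]
    refine mul_le_mul_of_nonneg_left ?_ (hε0 n).le
    have := hcontr n w
    rw [smul_apply] at this
    refine (norm_sub_le _ _).trans ?_
    linarith
  have hdense : DenseRange (gram J) := by
    have h : (LinearMap.range (gram J : V →ₗ[ℝ] V)).topologicalClosure = ⊤ := by
      rw [Submodule.topologicalClosure_eq_top_iff, Submodule.eq_bot_iff]
      intro v hv
      have h1 : inner ℝ (gram J v) v = 0 := hv _ ⟨v, rfl⟩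
      rw [inner_gram_left, inner_self_eq_zero] at h1
      exact hJ (by rw [h1, map_zero])
    have h2 := Submodule.dense_iff_topologicalClosure_eq_top.2 h
    exact h2
  intro v
  rw [Metric.tendsto_atTop]
  intro δ hδ
  obtain ⟨w, hw⟩ := hdense.exists_dist_lt v (half_pos hδ)
  obtain ⟨n0, hn0⟩ := Metric.tendsto_atTop.1 (hran w) (δ / 2) (half_pos hδ)
  refine ⟨n0, fun n hn => ?_⟩
  have h1 := hn0 n hn
  rw [dist_zero_right] at h1 ⊢
  have h2 := hcontr n (v - gram J w)
  rw [dist_eq_norm] at hw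
  have h3 : (ε n • R n) v = (ε n • R n) (v - gram J w) + (ε n • R n) (gram J w) := by
    rw [← map_add, sub_add_cancel]
  rw [h3]
  refine (norm_add_le _ _).trans_lt ?_
  linarith

theorem integrable_edge_of_memLp {E : Type*} [NormedAddCommGroup E] {T : ℝ} {f : ℝ → E}
    (hf : MemLp f 2 (edge T)) : Integrable f (edge T) :=
  hf.integrable one_le_two

theorem integrable_edge_mono {E : Type*} [NormedAddCommGroup E] {T t : ℝ} {f : ℝ → E}
    (hf : Integrable f (edge T)) (ht : t ≤ T) : Integrable f (edge t) :=
  IntegrableOn.mono_set hf (Ioo_subset_Ioo_right ht)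

theorem continuousOn_of_eq_primitive {E : Type*} [NormedAddCommGroup E] [NormedSpace ℝ E] {T : ℝ}
    {X f : ℝ → E} (hf : Integrable f (edge T))
    (hX : ∀ t ∈ Icc 0 T, X t = X 0 + ∫ τ in (0 : ℝ)..t, f τ) : ContinuousOn X (Icc 0 T) :=
  (continuousOn_const.add (continuousOn_primitive hf)).congr hX

theorem memLp_clm {E F : Type*} [NormedAddCommGroup E] [NormedSpace ℝ E] [NormedAddCommGroup F]
    [NormedSpace ℝ F] {T : ℝ} {f : ℝ → E} (L : E →L[ℝ] F) (hf : MemLp f 2 (edge T)) :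
    MemLp (fun t => L (f t)) 2 (edge T) :=
  L.comp_memLp' hf

theorem integrable_norm_sq {E : Type*} [NormedAddCommGroup E] {T : ℝ} {f : ℝ → E}
    (hf : MemLp f 2 (edge T)) : Integrable (fun t => ‖f t‖ ^ 2) (edge T) :=
  (memLp_two_iff_integrable_sq_norm hf.1).1 hf

theorem integrable_inner {E : Type*} [NormedAddCommGroup E] [InnerProductSpace ℝ E] {T : ℝ}
    {f g : ℝ → E}
    (hf : MemLp f 2 (edge T)) (hg : MemLp g 2 (edge T)) :
    Integrable (fun t => inner ℝ (f t) (g t)) (edge T) := by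
  refine ((integrable_norm_sq hf).add (integrable_norm_sq hg)).mono'
    (hf.1.inner hg.1) (Eventually.of_forall fun t => ?_)
  refine (norm_inner_le_norm _ _).trans ?_
  simp only [Pi.add_apply]
  nlinarith [two_mul_le_add_sq ‖f t‖ ‖g t‖, norm_nonneg (f t), norm_nonneg (g t)]

/-- The chain rule for `‖J w‖²` when `w` is absolutely continuous in `V`. -/
theorem norm_sq_primitive (J : V →L[ℝ] H) {T : ℝ} {w w' : ℝ → V} (hw' : Integrable w' (edge T))
    (hw : ∀ t ∈ Icc 0 T, w t = w 0 + ∫ τ in (0 : ℝ)..t, w' τ) {t : ℝ} (ht : t ∈ Icc 0 T) :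
    ‖J (w t)‖ ^ 2 = ‖J (w 0)‖ ^ 2
      + ∫ τ in (0 : ℝ)..t, 2 * inner ℝ (w τ) (gram J (w' τ)) := by
  have h := bilin_primitive ht.1 ((innerSL ℝ).bilinearComp J J) (X := w) (Y := w)
    (integrable_edge_mono hw' ht.2) (integrable_edge_mono hw' ht.2)
    (fun τ hτ => hw τ ⟨hτ.1, hτ.2.trans ht.2⟩) (fun τ hτ => hw τ ⟨hτ.1, hτ.2.trans ht.2⟩)
  simp only [ContinuousLinearMap.bilinearComp_apply, innerSL_apply_apply,
    real_inner_self_eq_norm_sq] at h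
  rw [h, integral_edge ht.1]
  congr 1
  refine intervalIntegral.integral_congr fun τ _ => ?_
  rw [inner_gram_right, real_inner_comm, two_mul]

/-- The bound of `‖J w‖` in `C([0, T]; H)` by the norms of `w` in `L²(0, T; V)` and of the time
derivative in `L²(0, T; V*)`, for absolutely continuous `w`. -/
theorem norm_sq_le_of_primitive (J : V →L[ℝ] H) {T : ℝ} (hT : 0 < T) {w w' : ℝ → V}
    (hw' : MemLp w' 2 (edge T))
    (hw : ∀ t ∈ Icc 0 T, w t = w 0 + ∫ τ in (0 : ℝ)..t, w' τ) {t : ℝ} (ht : t ∈ Icc 0 T) :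
    ‖J (w t)‖ ^ 2
      ≤ (‖J‖ ^ 2 / T + 1) * ∫ τ, (‖w τ‖ ^ 2 + ‖gram J (w' τ)‖ ^ 2) ∂edge T := by
  have hi := integrable_edge_of_memLp hw'
  have hwc := continuousOn_of_eq_primitive hi hw
  have hwL := memLp_edge_of_continuousOn hwc 2
  have hBL := memLp_clm (gram J) hw'
  have hsum := (integrable_norm_sq hwL).add (integrable_norm_sq hBL)
  set K := ∫ τ, (‖w τ‖ ^ 2 + ‖gram J (w' τ)‖ ^ 2) ∂edge T with hK
  have hp : Integrable (fun τ => 2 * inner ℝ (w τ) (gram J (w' τ))) (edge T) :=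
    (integrable_inner hwL hBL).const_mul 2
  have hpb : ∀ τ, ‖2 * inner ℝ (w τ) (gram J (w' τ))‖ ≤ ‖w τ‖ ^ 2 + ‖gram J (w' τ)‖ ^ 2 := by
    intro τ
    rw [norm_mul, Real.norm_two]
    have := norm_inner_le_norm (𝕜 := ℝ) (w τ) (gram J (w' τ))
    nlinarith [two_mul_le_add_sq ‖w τ‖ ‖gram J (w' τ)‖]
  have hdiff : ∀ r ∈ Icc 0 T, ‖J (w t)‖ ^ 2 - K ≤ ‖J (w r)‖ ^ 2 := by
    intro r hr
    have h1 := norm_sq_primitive J hi hw ht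
    have h2 := norm_sq_primitive J hi hw hr
    have h3 : ‖J (w t)‖ ^ 2 - ‖J (w r)‖ ^ 2
        = ∫ τ in r..t, 2 * inner ℝ (w τ) (gram J (w' τ)) := by
      rw [h1, h2, ← intervalIntegral.integral_interval_sub_left
        (intervalIntegrable_of_edge hp ⟨le_rfl, hT.le⟩ ht)
        (intervalIntegrable_of_edge hp ⟨le_rfl, hT.le⟩ hr)]
      ring
    have h4 : ∫ τ in r..t, 2 * inner ℝ (w τ) (gram J (w' τ)) ≤ K := by
      refine (le_abs_self _).trans ?_
      rw [← Real.norm_eq_abs]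
      refine intervalIntegral.norm_integral_le_integral_norm_uIoc.trans ?_
      have hsub : uIoc r t ⊆ Ioc 0 T := by
        intro x hx
        rw [uIoc, mem_Ioc] at hx
        exact ⟨(le_min hr.1 ht.1).trans_lt hx.1, hx.2.trans (max_le hr.2 ht.2)⟩
      have hsumI : IntegrableOn (fun τ => ‖w τ‖ ^ 2 + ‖gram J (w' τ)‖ ^ 2) (Ioc 0 T) := by
        rw [integrableOn_Ioc_iff_integrableOn_Ioo]; exact hsum
      have hpI : IntegrableOn (fun τ => 2 * inner ℝ (w τ) (gram J (w' τ))) (Ioc 0 T) := by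
        rw [integrableOn_Ioc_iff_integrableOn_Ioo]; exact hp
      rw [hK, ← integral_Ioc_eq_integral_Ioo]
      refine (setIntegral_mono_on (hpI.mono_set hsub).norm (hsumI.mono_set hsub)
        measurableSet_uIoc fun τ _ => hpb τ).trans ?_
      exact setIntegral_mono_set hsumI (Eventually.of_forall fun τ => by positivity)
        hsub.eventuallyLE
    linarith
  have hJw : Integrable (fun r => ‖J (w r)‖ ^ 2) (edge T) := integrable_norm_sq (memLp_clm J hwL)
  have havg : T * (‖J (w t)‖ ^ 2 - K) ≤ ‖J‖ ^ 2 * K := by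
    calc T * (‖J (w t)‖ ^ 2 - K) = ∫ _, (‖J (w t)‖ ^ 2 - K) ∂edge T := by
          rw [integral_const, measureReal_restrict_apply_univ, Real.volume_real_Ioo_of_le hT.le,
            sub_zero, smul_eq_mul]
      _ ≤ ∫ r, ‖J (w r)‖ ^ 2 ∂edge T :=
          setIntegral_mono_on (integrable_const _) hJw measurableSet_Ioo
            fun r hr => hdiff r (Ioo_subset_Icc_self hr)
      _ ≤ ∫ r, ‖J‖ ^ 2 * (‖w r‖ ^ 2 + ‖gram J (w' r)‖ ^ 2) ∂edge T := by
          refine integral_mono hJw (hsum.const_mul _) fun r => ?_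
          have h1 := J.le_opNorm (w r)
          have h2 : ‖J (w r)‖ ^ 2 ≤ (‖J‖ * ‖w r‖) ^ 2 := by gcongr
          have h3 : 0 ≤ ‖J‖ ^ 2 * ‖gram J (w' r)‖ ^ 2 := by positivity
          beta_reduce
          nlinarith
      _ = ‖J‖ ^ 2 * K := integral_const_mul _ _
  have : ‖J (w t)‖ ^ 2 - K ≤ ‖J‖ ^ 2 * K / T := by
    rw [le_div_iff₀ hT]; linarith
  calc ‖J (w t)‖ ^ 2 ≤ ‖J‖ ^ 2 * K / T + K := by linarith
    _ = _ := by ring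

theorem tendsto_integral_norm_sq {E : Type*} [NormedAddCommGroup E] [NormedSpace ℝ E]
    {e : ℕ → E →L[ℝ] E} (he : ∀ n v, ‖e n v‖ ≤ ‖v‖)
    (he0 : ∀ v, Tendsto (fun n => e n v) atTop (𝓝 0)) {T : ℝ} {f : ℝ → E}
    (hf : MemLp f 2 (edge T)) :
    Tendsto (fun n => ∫ t, ‖e n (f t)‖ ^ 2 ∂edge T) atTop (𝓝 0) := by
  have h := tendsto_integral_of_dominated_convergence (μ := edge T)
    (F := fun n t => ‖e n (f t)‖ ^ 2) (f := fun _ => (0 : ℝ)) (fun t => ‖f t‖ ^ 2)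
    (fun n => (integrable_norm_sq (memLp_clm (e n) hf)).1) (integrable_norm_sq hf)
    (fun n => Eventually.of_forall fun t => by
      have := he n (f t)
      rw [Real.norm_of_nonneg (by positivity)]
      gcongr)
    (Eventually.of_forall fun t => by
      have := ((he0 (f t)).norm).pow 2
      simpa using this)
  simpa using h

/-- The energy identity for absolutely continuous `w : [0, T] → V`, with a weight `m`. -/
theorem energy_of_primitive (J : V →L[ℝ] H) {T : ℝ} (hT : 0 ≤ T) {w w' : ℝ → V}
    (hw' : MemLp w' 2 (edge T)) (hw : ∀ t ∈ Icc 0 T, w t = w 0 + ∫ τ in (0 : ℝ)..t, w' τ)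
    {m : ℝ → ℝ} (hm : ContDiff ℝ 1 m) :
    m T * ‖J (w T)‖ ^ 2 = m 0 * ‖J (w 0)‖ ^ 2
      + ∫ t, (deriv m t * ‖J (w t)‖ ^ 2 + m t * (2 * inner ℝ (w t) (gram J (w' t)))) ∂edge T := by
  have hi := integrable_edge_of_memLp hw'
  have hwL := memLp_edge_of_continuousOn (continuousOn_of_eq_primitive hi hw) 2
  exact integral_deriv_smul_add hT hm (Y := fun t => ‖J (w t)‖ ^ 2)
    ((integrable_inner hwL (memLp_clm (gram J) hw')).const_mul 2)
    fun t ht => norm_sq_primitive J hi hw ht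

/-- If `(J†J ρ)' = s` with `ρ, s ∈ L²(0, T; V)`, then `J ρ` has a representative in `C([0, T]; H)`,
which satisfies the energy identity with any `C¹` weight. In terms of the Hilbert triple
`V ⊆ H ⊆ V*`, `s` is the Riesz representative of the time derivative of `ρ` in `L²(0, T; V*)`. -/
theorem exists_continuous_representative (J : V →L[ℝ] H) (hJ : Function.Injective J) {T : ℝ}
    (hT : 0 < T) {ρ s : ℝ → V} (hρ : MemLp ρ 2 (edge T)) (hs : MemLp s 2 (edge T)) (a : V)
    (h : ∀ᵐ t ∂edge T, gram J (ρ t) = a + ∫ τ in (0 : ℝ)..t, s τ) :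
    ∃ c : ℝ → H, ContinuousOn c (Icc 0 T) ∧ (∀ᵐ t ∂edge T, J (ρ t) = c t) ∧
      (∀ t ∈ Icc 0 T, J.adjoint (c t) = a + ∫ τ in (0 : ℝ)..t, s τ) ∧
      ∀ m : ℝ → ℝ, ContDiff ℝ 1 m → m T * ‖c T‖ ^ 2 = m 0 * ‖c 0‖ ^ 2
        + ∫ t, (deriv m t * ‖J (ρ t)‖ ^ 2 + m t * (2 * inner ℝ (ρ t) (s t))) ∂edge T := by
  obtain ⟨R, e, hBR, hRB, he, he0⟩ := exists_yosida J hJ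
  have hsi := integrable_edge_of_memLp hs
  have h0T : (0 : ℝ) ∈ Icc 0 T := ⟨le_rfl, hT.le⟩
  have hTT : T ∈ Icc 0 T := ⟨hT.le, le_rfl⟩
  set Z : ℝ → V := fun t => a + ∫ τ in (0 : ℝ)..t, s τ with hZ
  -- any bounded operator applied to `Z` is absolutely continuous in `V`
  have hprim : ∀ (L : V →L[ℝ] V), ∀ t ∈ Icc 0 T,
      L (Z t) = L (Z 0) + ∫ τ in (0 : ℝ)..t, L (s τ) := by
    intro L t ht
    rw [L.intervalIntegral_comp_comm (intervalIntegrable_of_edge hsi h0T ht), ← map_add]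
    simp [hZ]
  have hRZ : ∀ n, ∀ᵐ t ∂edge T, R n (Z t) = ρ t - e n (ρ t) := fun n => by
    filter_upwards [h] with t ht
    rw [← hRB, ht]
  -- the representatives are Cauchy in `C([0, T]; H)`
  set δ : ℕ → ℝ := fun n => (∫ t, ‖e n (ρ t)‖ ^ 2 ∂edge T) + ∫ t, ‖e n (s t)‖ ^ 2 ∂edge T with hδ
  have hδ0 : Tendsto δ atTop (𝓝 0) := by
    simpa using (tendsto_integral_norm_sq he he0 hρ).add (tendsto_integral_norm_sq he he0 hs)
  set C : ℝ := ‖J‖ ^ 2 / T + 1 with hC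
  have hC0 : 0 < C := by positivity
  have hbound : ∀ n k, ∀ t ∈ Icc 0 T,
      ‖J (R n (Z t)) - J (R k (Z t))‖ ^ 2 ≤ C * (2 * (δ n + δ k)) := by
    intro n k t ht
    have h1 := norm_sq_le_of_primitive J hT (w := fun t => (R n - R k) (Z t))
      (w' := fun t => (R n - R k) (s t)) (memLp_clm (R n - R k) hs) (hprim (R n - R k)) ht
    rw [← map_sub]
    refine h1.trans (mul_le_mul_of_nonneg_left ?_ hC0.le)
    have i1 := integrable_norm_sq (memLp_clm (e n) hρ)
    have i2 := integrable_norm_sq (memLp_clm (e k) hρ)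
    have i3 := integrable_norm_sq (memLp_clm (e n) hs)
    have i4 := integrable_norm_sq (memLp_clm (e k) hs)
    have hle : ∀ x y : V, ‖x - y‖ ^ 2 ≤ 2 * (‖x‖ ^ 2 + ‖y‖ ^ 2) := fun x y => by
      have := norm_sub_le x y
      nlinarith [sq_nonneg (‖x‖ - ‖y‖), norm_nonneg (x - y), norm_nonneg x, norm_nonneg y]
    have e1 : 2 * (δ n + δ k) = ∫ t, 2 * ((‖e n (ρ t)‖ ^ 2 + ‖e n (s t)‖ ^ 2)
        + (‖e k (ρ t)‖ ^ 2 + ‖e k (s t)‖ ^ 2)) ∂edge T := by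
      rw [integral_const_mul, integral_add (by exact i1.add i3) (by exact i2.add i4),
        integral_add i1 i3, integral_add i2 i4]
    rw [e1]
    refine integral_mono_of_nonneg (Eventually.of_forall fun t => by positivity)
      (((i1.add i3).add (i2.add i4)).const_mul 2) ?_
    filter_upwards [hRZ n, hRZ k] with t h1 h2
    have h3 : (R n - R k) (Z t) = e k (ρ t) - e n (ρ t) := by
      rw [sub_apply, h1, h2]; abel
    have h4 : gram J ((R n - R k) (s t)) = e k (s t) - e n (s t) := by
      rw [sub_apply, map_sub, hBR, hBR]; abel
    simp only [h3, h4]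
    linarith [hle (e k (ρ t)) (e n (ρ t)), hle (e k (s t)) (e n (s t))]
  have hcau : UniformCauchySeqOn (fun n t => J (R n (Z t))) atTop (Icc 0 T) := by
    rw [Metric.uniformCauchySeqOn_iff]
    intro η hη
    have hη' : 0 < η ^ 2 / (4 * C) := by positivity
    obtain ⟨N, hN⟩ := (hδ0.eventually (gt_mem_nhds hη')).exists_forall_of_atTop
    refine ⟨N, fun n hn k hk t ht => ?_⟩
    rw [dist_eq_norm]
    refine lt_of_pow_lt_pow_left₀ 2 hη.le ((hbound n k t ht).trans_lt ?_)
    have h1 := hN n hn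
    have h2 := hN k hk
    calc C * (2 * (δ n + δ k)) < C * (2 * (η ^ 2 / (4 * C) + η ^ 2 / (4 * C))) := by gcongr
      _ = η ^ 2 := by field_simp; ring
  have hlim : ∀ t, ∃ y, t ∈ Icc 0 T → Tendsto (fun n => J (R n (Z t))) atTop (𝓝 y) := by
    intro t
    by_cases ht : t ∈ Icc 0 T
    · obtain ⟨y, hy⟩ := cauchySeq_tendsto_of_complete (hcau.cauchySeq ht)
      exact ⟨y, fun _ => hy⟩
    · exact ⟨0, fun h => absurd h ht⟩
  choose c hc using hlim
  have hZc : ContinuousOn Z (Icc 0 T) := continuousOn_const.add (continuousOn_primitive hsi)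
  have hRc : ∀ n, ContinuousOn (fun t => J (R n (Z t))) (Icc 0 T) := fun n =>
    (J.comp (R n)).continuous.comp_continuousOn hZc
  have hρlim : ∀ v, Tendsto (fun n => v - e n v) atTop (𝓝 v) := fun v => by
    simpa using tendsto_const_nhds.sub (he0 v)
  refine ⟨c, ?_, ?_, ?_, ?_⟩
  · exact (hcau.tendstoUniformlyOn_of_tendsto fun t ht => hc t ht).continuousOn
      (Frequently.of_forall hRc)
  · filter_upwards [ae_all_iff.2 hRZ, ae_restrict_mem measurableSet_Ioo] with t ht htI
    refine tendsto_nhds_unique ?_ (hc t (Ioo_subset_Icc_self htI))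
    simp only [ht]
    exact (J.continuous.tendsto _).comp (hρlim (ρ t))
  · intro t ht
    refine tendsto_nhds_unique ((J.adjoint.continuous.tendsto _).comp (hc t ht)) ?_
    refine (hρlim (Z t)).congr fun n => ?_
    rw [← hBR]; rfl
  · intro m hm
    have hmc : ContinuousOn m (Icc 0 T) := hm.continuous.continuousOn
    have hmd : ContinuousOn (deriv m) (Icc 0 T) := (hm.continuous_deriv (by simp)).continuousOn
    obtain ⟨M, hM0, hM⟩ := exists_bound_of_continuousOn hmc
    obtain ⟨M', hM'0, hM'⟩ := exists_bound_of_continuousOn hmd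
    have hen := fun n => energy_of_primitive J hT.le (memLp_clm (R n) hs) (hprim (R n)) hm
    have hT1 : Tendsto (fun n => m T * ‖J (R n (Z T))‖ ^ 2) atTop (𝓝 (m T * ‖c T‖ ^ 2)) :=
      ((hc T hTT).norm.pow 2).const_mul _
    have hT0 : Tendsto (fun n => m 0 * ‖J (R n (Z 0))‖ ^ 2) atTop (𝓝 (m 0 * ‖c 0‖ ^ 2)) :=
      ((hc 0 h0T).norm.pow 2).const_mul _
    refine tendsto_nhds_unique hT1 ((hT0.add ?_).congr fun n => (hen n).symm)
    have hRL : ∀ n, MemLp (fun t => R n (Z t)) 2 (edge T) := fun n =>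
      memLp_edge_of_continuousOn ((R n).continuous.comp_continuousOn hZc) 2
    refine tendsto_integral_of_dominated_convergence
      (fun t => M' * (‖J‖ * (2 * ‖ρ t‖)) ^ 2 + M * (4 * (2 * (‖ρ t‖ ^ 2 + ‖s t‖ ^ 2)))) ?_ ?_ ?_ ?_
    · intro n
      have j1 := integrable_bilin_right (ContinuousLinearMap.lsmul ℝ ℝ) hmd
        (integrable_norm_sq (memLp_clm J (hRL n)))
      have j2 := integrable_bilin_right (ContinuousLinearMap.lsmul ℝ ℝ) hmc
        ((integrable_inner (hRL n) (memLp_clm (gram J) (memLp_clm (R n) hs))).const_mul 2)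
      exact (j1.add j2).1
    · refine Integrable.add ?_ ?_
      · simp only [mul_pow]
        exact (((integrable_norm_sq hρ).const_mul _).const_mul _).const_mul _
      · have i := (integrable_norm_sq hρ).add (integrable_norm_sq hs)
        exact ((i.const_mul _).const_mul _).const_mul _
    · intro n
      filter_upwards [hRZ n, ae_restrict_mem measurableSet_Ioo] with t ht htI
      have ht' := Ioo_subset_Icc_self htI
      have hsub : ∀ v, ‖v - e n v‖ ≤ 2 * ‖v‖ := fun v =>
        (norm_sub_le _ _).trans (by linarith [he n v])
      rw [ht, hBR]
      refine (norm_add_le _ _).trans (add_le_add ?_ ?_)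
      · rw [norm_mul, norm_pow, norm_norm]
        have h1 := hM' t ht'
        have h2 := (J.le_opNorm (ρ t - e n (ρ t))).trans
          (mul_le_mul_of_nonneg_left (hsub (ρ t)) (norm_nonneg J))
        gcongr
      · rw [norm_mul, norm_mul, Real.norm_two]
        have h1 := hM t ht'
        have h2 := norm_inner_le_norm (𝕜 := ℝ) (ρ t - e n (ρ t)) (s t - e n (s t))
        have h3 : ‖ρ t - e n (ρ t)‖ * ‖s t - e n (s t)‖ ≤ (2 * ‖ρ t‖) * (2 * ‖s t‖) := by
          have := hsub (ρ t)
          have := hsub (s t)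
          gcongr
        have h4 : 2 * ‖inner ℝ (ρ t - e n (ρ t)) (s t - e n (s t))‖
            ≤ 4 * (2 * (‖ρ t‖ ^ 2 + ‖s t‖ ^ 2)) := by
          nlinarith [two_mul_le_add_sq ‖ρ t‖ ‖s t‖, sq_nonneg ‖ρ t‖, sq_nonneg ‖s t‖]
        gcongr
    · filter_upwards [ae_all_iff.2 hRZ] with t ht
      simp only [ht, hBR]
      exact ((((J.continuous.tendsto _).comp (hρlim (ρ t))).norm.pow 2).const_mul _).add
        ((((hρlim (ρ t)).inner (hρlim (s t))).const_mul 2).const_mul _)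

end Energy

/-! ### Abstract linear parabolic equations -/

section Parabolic

open Filter Topology

variable {V H : Type*} [NormedAddCommGroup V] [InnerProductSpace ℝ V]
  [NormedAddCommGroup H] [InnerProductSpace ℝ H] {T : ℝ}

/-- `J ρ` has a representative in `C([0, T]; H)` with value `h` at time `0`. -/
def HasTrace (J : V →L[ℝ] H) (ρ : Lp V 2 (edge T)) (h : H) : Prop :=
  ∃ c : ℝ → H, ContinuousOn c (Icc 0 T) ∧ (∀ᵐ t ∂edge T, J (ρ t) = c t) ∧ c 0 = h

theorem HasTrace.unique {J : V →L[ℝ] H} (hT : 0 < T) {ρ : Lp V 2 (edge T)} {h h' : H}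
    (H1 : HasTrace J ρ h) (H2 : HasTrace J ρ h') : h = h' := by
  obtain ⟨c, hc, hρ, rfl⟩ := H1
  obtain ⟨c', hc', hρ', rfl⟩ := H2
  refine eqOn_Icc_of_ae_eq hT hc hc' ?_ ⟨le_rfl, hT.le⟩
  filter_upwards [hρ, hρ'] with t h1 h2
  rw [← h1, h2]

theorem HasTrace.add {J : V →L[ℝ] H} {ρ ρ' : Lp V 2 (edge T)} {h h' : H}
    (H1 : HasTrace J ρ h) (H2 : HasTrace J ρ' h') : HasTrace J (ρ + ρ') (h + h') := by
  obtain ⟨c, hc, hρ, rfl⟩ := H1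
  obtain ⟨c', hc', hρ', rfl⟩ := H2
  refine ⟨fun t => c t + c' t, hc.add hc', ?_, rfl⟩
  filter_upwards [hρ, hρ', Lp.coeFn_add ρ ρ'] with t h1 h2 h3
  rw [h3, Pi.add_apply, map_add, h1, h2]

theorem HasTrace.smul {J : V →L[ℝ] H} {ρ : Lp V 2 (edge T)} {h : H} (r : ℝ)
    (H1 : HasTrace J ρ h) : HasTrace J (r • ρ) (r • h) := by
  obtain ⟨c, hc, hρ, rfl⟩ := H1
  refine ⟨fun t => r • c t, hc.const_smul r, ?_, rfl⟩
  filter_upwards [hρ, Lp.coeFn_smul r ρ] with t h1 h3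
  rw [h3, Pi.smul_apply, map_smul, h1]

theorem HasTrace.sub {J : V →L[ℝ] H} {ρ ρ' : Lp V 2 (edge T)} {h h' : H}
    (H1 : HasTrace J ρ h) (H2 : HasTrace J ρ' h') : HasTrace J (ρ - ρ') (h - h') := by
  simpa [sub_eq_add_neg] using H1.add (H2.smul (-1))

theorem lp_integrable {E : Type*} [NormedAddCommGroup E] (ρ : Lp E 2 (edge T)) :
    Integrable ρ (edge T) :=
  integrable_edge_of_memLp (Lp.memLp ρ)

theorem integrable_smul_lp {E : Type*} [NormedAddCommGroup E] [NormedSpace ℝ E]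
    {η : ℝ → ℝ} (hη : MemLp η 2 (edge T)) (f : Lp E 2 (edge T)) :
    Integrable (fun t => η t • f t) (edge T) :=
  memLp_one_iff_integrable.1 ((Lp.memLp f).smul hη)

theorem continuous_integral_smul {E : Type*} [NormedAddCommGroup E] [NormedSpace ℝ E]
    {η : ℝ → ℝ} (hη : MemLp η 2 (edge T)) :
    Continuous fun f : Lp E 2 (edge T) => ∫ t, η t • f t ∂edge T := by
  have hint := integrable_smul_lp (E := E) hη
  let L : Lp E 2 (edge T) →ₗ[ℝ] E :=
    { toFun := fun f => ∫ t, η t • f t ∂edge T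
      map_add' := fun f g => by
        rw [← integral_add (hint f) (hint g)]
        refine integral_congr_ae ?_
        filter_upwards [Lp.coeFn_add f g] with t ht
        rw [ht, Pi.add_apply, smul_add]
      map_smul' := fun r f => by
        rw [RingHom.id_apply, ← integral_smul]
        refine integral_congr_ae ?_
        filter_upwards [Lp.coeFn_smul r f] with t ht
        rw [ht, Pi.smul_apply, smul_comm] }
  refine AddMonoidHomClass.continuous_of_bound L (eLpNorm η 2 (edge T)).toReal fun f => ?_
  refine (norm_integral_le_integral_norm _).trans ?_
  rw [integral_norm_eq_lintegral_enorm (hint f).1, ← eLpNorm_one_eq_lintegral_enorm, Lp.norm_def,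
    ← ENNReal.toReal_mul]
  exact ENNReal.toReal_mono (ENNReal.mul_ne_top hη.2.ne (Lp.memLp f).2.ne)
    (eLpNorm_smul_le_mul_eLpNorm (Lp.memLp f).1 hη.1)

theorem lp_norm_sq (f : Lp V 2 (edge T)) : ‖f‖ ^ 2 = ∫ t, ‖f t‖ ^ 2 ∂edge T := by
  rw [← real_inner_self_eq_norm_sq, L2.inner_def]
  simp only [real_inner_self_eq_norm_sq]

theorem lp_integrable_norm_sq {E : Type*} [NormedAddCommGroup E] (f : Lp E 2 (edge T)) :
    Integrable (fun t => ‖f t‖ ^ 2) (edge T) :=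
  integrable_norm_sq (Lp.memLp f)

/-- `t ↦ θ(t) φ` as an element of `L²(0, T; E)`. -/
def smulConst {E : Type*} [NormedAddCommGroup E] [NormedSpace ℝ E] (T : ℝ) {θ : ℝ → ℝ}
    (hθ : Continuous θ) (φ : E) : Lp E 2 (edge T) :=
  (memLp_edge_of_continuousOn (T := T) (f := fun t => θ t • φ)
    (by fun_prop : Continuous fun t => θ t • φ).continuousOn 2).toLp

theorem coeFn_smulConst {E : Type*} [NormedAddCommGroup E] [NormedSpace ℝ E] (T : ℝ) {θ : ℝ → ℝ}
    (hθ : Continuous θ) (φ : E) :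
    ∀ᵐ t ∂edge T, smulConst T hθ φ t = θ t • φ :=
  MemLp.coeFn_toLp _

theorem hasTrace_smulConst (J : V →L[ℝ] H) {θ : ℝ → ℝ} (hθ : Continuous θ) (φ : V) :
    HasTrace J (smulConst T hθ φ) (θ 0 • J φ) := by
  refine ⟨fun t => θ t • J φ, (by fun_prop : Continuous fun t => θ t • J φ).continuousOn, ?_, rfl⟩
  filter_upwards [coeFn_smulConst T hθ φ] with t ht
  rw [ht, map_smul]

variable [CompleteSpace V] [CompleteSpace H]

/-- `s` is the time derivative of `ρ` in `L²(0, T; V*)`, read in `V` through the Riesz isomorphism: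
`J†J ρ` is a primitive of `s`. -/
def IsRieszTimeDeriv (J : V →L[ℝ] H) (ρ s : Lp V 2 (edge T)) : Prop :=
  ∃ a, ∀ᵐ t ∂edge T, gram J (ρ t) = a + ∫ τ in (0 : ℝ)..t, s τ

theorem isRieszTimeDeriv_iff (hT : 0 < T) (J : V →L[ℝ] H) (ρ s : Lp V 2 (edge T)) :
    IsRieszTimeDeriv J ρ s ↔ ∀ θ, IsTest 0 T θ →
      ∫ t in Ioo 0 T, deriv θ t • gram J (ρ t) = -∫ t in Ioo 0 T, θ t • s t := by
  constructor
  · rintro ⟨a, ha⟩ θ hθ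
    rw [← hθ.integral_deriv_smul hT.le (lp_integrable s)
      (Y := fun t => a + ∫ τ in (0 : ℝ)..t, s τ) (fun t _ => by simp)]
    refine integral_congr_ae ?_
    filter_upwards [ha] with t ht
    rw [ht]
  · intro h
    exact exists_ae_eq_primitive hT ((gram J).integrable_comp (lp_integrable ρ))
      (lp_integrable s) h

theorem IsRieszTimeDeriv.of_tendsto {J : V →L[ℝ] H} (hT : 0 < T) {ρ s : ℕ → Lp V 2 (edge T)}
    (h : ∀ n, IsRieszTimeDeriv J (ρ n) (s n)) {ρ' s' : Lp V 2 (edge T)}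
    (hρ : Tendsto ρ atTop (𝓝 ρ')) (hs : Tendsto s atTop (𝓝 s')) : IsRieszTimeDeriv J ρ' s' := by
  rw [isRieszTimeDeriv_iff hT]
  intro θ hθ
  have e : ∀ ρ : Lp V 2 (edge T), ∫ t in Ioo 0 T, deriv θ t • gram J (ρ t)
      = gram J (∫ t, deriv θ t • ρ t ∂edge T) := fun ρ => by
    rw [← (gram J).integral_comp_comm (integrable_smul_lp (hθ.memLp_deriv (edge T)) ρ)]
    simp only [map_smul]
  have h1 : Tendsto (fun n => gram J (∫ t, deriv θ t • ρ n t ∂edge T)) atTop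
      (𝓝 (gram J (∫ t, deriv θ t • ρ' t ∂edge T))) :=
    ((gram J).continuous.tendsto _).comp
      (((continuous_integral_smul (hθ.memLp_deriv (edge T))).tendsto ρ').comp hρ)
  have h2 : Tendsto (fun n => -∫ t, θ t • s n t ∂edge T) atTop (𝓝 (-∫ t, θ t • s' t ∂edge T)) :=
    (((continuous_integral_smul (hθ.memLp (edge T))).tendsto s').comp hs).neg
  rw [e]
  refine tendsto_nhds_unique h1 (h2.congr fun n => ?_)
  rw [← e, (isRieszTimeDeriv_iff hT J _ _).1 (h n) θ hθ]

theorem IsRieszTimeDeriv.add {J : V →L[ℝ] H} {ρ ρ' s s' : Lp V 2 (edge T)}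
    (h : IsRieszTimeDeriv J ρ s) (h' : IsRieszTimeDeriv J ρ' s') :
    IsRieszTimeDeriv J (ρ + ρ') (s + s') := by
  obtain ⟨a, ha⟩ := h
  obtain ⟨a', ha'⟩ := h'
  refine ⟨a + a', ?_⟩
  filter_upwards [ha, ha', Lp.coeFn_add ρ ρ', ae_restrict_mem measurableSet_Ioo] with t h1 h2 h3 ht
  have hT : 0 ≤ T := (ht.1.trans ht.2).le
  have hi : ∀ f : Lp V 2 (edge T), IntervalIntegrable f volume 0 t := fun f =>
    intervalIntegrable_of_edge (lp_integrable f) ⟨le_rfl, hT⟩ (Ioo_subset_Icc_self ht)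
  have e : ∫ τ in (0 : ℝ)..t, (s + s') τ
      = (∫ τ in (0 : ℝ)..t, s τ) + ∫ τ in (0 : ℝ)..t, s' τ := by
    rw [← intervalIntegral.integral_add (hi s) (hi s')]
    refine intervalIntegral.integral_congr_ae ?_
    have := (ae_restrict_iff' measurableSet_Ioo).1 (Lp.coeFn_add s s')
    filter_upwards [this] with τ hτ hτ'
    rw [uIoc_of_le ht.1.le] at hτ'
    exact hτ ⟨hτ'.1, hτ'.2.trans_lt ht.2⟩
  rw [h3, Pi.add_apply, map_add, h1, h2, e]
  abel

theorem IsRieszTimeDeriv.smul {J : V →L[ℝ] H} {ρ s : Lp V 2 (edge T)} (r : ℝ)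
    (h : IsRieszTimeDeriv J ρ s) : IsRieszTimeDeriv J (r • ρ) (r • s) := by
  obtain ⟨a, ha⟩ := h
  refine ⟨r • a, ?_⟩
  filter_upwards [ha, Lp.coeFn_smul r ρ, ae_restrict_mem measurableSet_Ioo] with t h1 h3 ht
  have e : ∫ τ in (0 : ℝ)..t, (r • s) τ = r • ∫ τ in (0 : ℝ)..t, s τ := by
    rw [← intervalIntegral.integral_smul]
    refine intervalIntegral.integral_congr_ae ?_
    have := (ae_restrict_iff' measurableSet_Ioo).1 (Lp.coeFn_smul r s)
    filter_upwards [this] with τ hτ hτ'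
    rw [uIoc_of_le ht.1.le] at hτ'
    exact hτ ⟨hτ'.1, hτ'.2.trans_lt ht.2⟩
  rw [h3, Pi.smul_apply, map_smul, h1, e, smul_add]

/-- Existence of the continuous representative and the energy identity, for classes in `L²`. -/
theorem IsRieszTimeDeriv.exists_representative {J : V →L[ℝ] H} (hJ : Function.Injective J)
    (hT : 0 < T) {ρ s : Lp V 2 (edge T)} (h : IsRieszTimeDeriv J ρ s) :
    ∃ c : ℝ → H, ContinuousOn c (Icc 0 T) ∧ (∀ᵐ t ∂edge T, J (ρ t) = c t) ∧
      (∀ t ∈ Icc 0 T, J.adjoint (c t) = J.adjoint (c 0) + ∫ τ in (0 : ℝ)..t, s τ) ∧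
      ∀ m : ℝ → ℝ, ContDiff ℝ 1 m → m T * ‖c T‖ ^ 2 = m 0 * ‖c 0‖ ^ 2
        + ∫ t, (deriv m t * ‖J (ρ t)‖ ^ 2 + m t * (2 * inner ℝ (ρ t) (s t))) ∂edge T := by
  obtain ⟨a, ha⟩ := h
  obtain ⟨c, h1, h2, h3, h4⟩ :=
    exists_continuous_representative J hJ hT (Lp.memLp ρ) (Lp.memLp s) a ha
  refine ⟨c, h1, h2, fun t ht => ?_, h4⟩
  rw [h3 t ht, h3 0 ⟨le_rfl, hT.le⟩]
  simp

theorem IsRieszTimeDeriv.exists_hasTrace {J : V →L[ℝ] H} (hJ : Function.Injective J)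
    (hT : 0 < T) {ρ s : Lp V 2 (edge T)} (h : IsRieszTimeDeriv J ρ s) : ∃ k, HasTrace J ρ k := by
  obtain ⟨c, h1, h2, -⟩ := h.exists_representative hJ hT
  exact ⟨c 0, c, h1, h2, rfl⟩

/-- The trace at time `0` is bounded: the energy identity with the weight `t / T - 1`. -/
theorem exists_trace_bound (J : V →L[ℝ] H) (hJ : Function.Injective J) (hT : 0 < T) :
    ∃ C, 0 ≤ C ∧ ∀ (ρ s : Lp V 2 (edge T)) (h : H), IsRieszTimeDeriv J ρ s → HasTrace J ρ h →
      ‖h‖ ^ 2 ≤ C * (‖ρ‖ ^ 2 + ‖s‖ ^ 2) := by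
  refine ⟨‖J‖ ^ 2 / T + 1, by positivity, fun ρ s h hd hh => ?_⟩
  obtain ⟨c, h1, h2, -, h4⟩ := hd.exists_representative hJ hT
  have e : h = c 0 := hh.unique hT ⟨c, h1, h2, rfl⟩
  have hm : ContDiff ℝ 1 (fun t : ℝ => t / T - 1) := by fun_prop
  have hder : ∀ t : ℝ, deriv (fun t : ℝ => t / T - 1) t = 1 / T := fun t => by
    simp
  have h5 := h4 _ hm
  simp only [hder, div_self hT.ne', sub_self, zero_mul, zero_div, zero_sub] at h5
  rw [e]
  have i1 := lp_integrable_norm_sq ρ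
  have i2 := lp_integrable_norm_sq s
  calc ‖c 0‖ ^ 2
      = ∫ t, (1 / T * ‖J (ρ t)‖ ^ 2 + (t / T - 1) * (2 * inner ℝ (ρ t) (s t))) ∂edge T := by
        linarith
    _ ≤ ∫ t, (‖J‖ ^ 2 / T + 1) * (‖ρ t‖ ^ 2 + ‖s t‖ ^ 2) ∂edge T := by
        refine setIntegral_mono_on ?_ ((i1.add i2).const_mul _) measurableSet_Ioo fun t ht => ?_
        · refine ((integrable_norm_sq (memLp_clm J (Lp.memLp ρ))).const_mul _).add ?_
          exact integrable_bilin_right (ContinuousLinearMap.lsmul ℝ ℝ)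
            hm.continuous.continuousOn
            ((integrable_inner (Lp.memLp ρ) (Lp.memLp s)).const_mul 2)
        · have a1 : ‖J (ρ t)‖ ^ 2 ≤ (‖J‖ * ‖ρ t‖) ^ 2 := by
            have := J.le_opNorm (ρ t)
            gcongr
          have a2 : 1 / T * ‖J (ρ t)‖ ^ 2 ≤ ‖J‖ ^ 2 / T * (‖ρ t‖ ^ 2 + ‖s t‖ ^ 2) := by
            calc 1 / T * ‖J (ρ t)‖ ^ 2 ≤ 1 / T * (‖J‖ * ‖ρ t‖) ^ 2 := by gcongr
              _ = ‖J‖ ^ 2 / T * ‖ρ t‖ ^ 2 := by ring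
              _ ≤ _ := by gcongr; nlinarith [sq_nonneg ‖s t‖]
          have a3 : (t / T - 1) * (2 * inner ℝ (ρ t) (s t)) ≤ ‖ρ t‖ ^ 2 + ‖s t‖ ^ 2 := by
            refine (le_abs_self _).trans ?_
            rw [abs_mul, abs_mul, abs_two]
            have b1 : |t / T - 1| ≤ 1 := by
              have q1 : 0 < t / T := div_pos ht.1 hT
              have q2 : t / T < 1 := (div_lt_one hT).2 ht.2
              rw [abs_le]; constructor <;> linarith
            have b2 := abs_real_inner_le_norm (ρ t) (s t)
            calc |t / T - 1| * (2 * |inner ℝ (ρ t) (s t)|)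
                ≤ 1 * (2 * (‖ρ t‖ * ‖s t‖)) := by gcongr
              _ ≤ _ := by nlinarith [two_mul_le_add_sq ‖ρ t‖ ‖s t‖]
          linarith
    _ = _ := by
        rw [integral_const_mul, integral_add i1 i2, ← lp_norm_sq, ← lp_norm_sq]

/-- `A` satisfies a Gårding inequality at almost every time. -/
def IsGarding (J : V →L[ℝ] H) (A : Lp V 2 (edge T) →L[ℝ] Lp V 2 (edge T)) (α β : ℝ) : Prop :=
  ∀ ρ : Lp V 2 (edge T), ∀ᵐ t ∂edge T,
    α * ‖ρ t‖ ^ 2 - β * ‖J (ρ t)‖ ^ 2 ≤ inner ℝ (A ρ t) (ρ t)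

theorem contDiff_exp_mul (b : ℝ) : ContDiff ℝ 1 fun t : ℝ => Real.exp (b * t) := by fun_prop

theorem deriv_exp_mul (b t : ℝ) :
    deriv (fun t : ℝ => Real.exp (b * t)) t = b * Real.exp (b * t) := by
  have h : HasDerivAt (fun t : ℝ => Real.exp (b * t)) (Real.exp (b * t) * (b * 1)) t :=
    ((hasDerivAt_id t).const_mul b).exp
  rw [h.deriv]; ring

/-- A priori estimate: the energy identity with the weight `exp (-2βt)`, which absorbs the lower
order term of the Gårding inequality. -/
theorem exists_apriori_bound (J : V →L[ℝ] H) (hJ : Function.Injective J) (hT : 0 < T)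
    {A : Lp V 2 (edge T) →L[ℝ] Lp V 2 (edge T)} {α β : ℝ} (hα : 0 < α) (hβ : 0 ≤ β)
    (hA : IsGarding J A α β) :
    ∃ C, 0 ≤ C ∧ ∀ (ρ s : Lp V 2 (edge T)) (h : H), IsRieszTimeDeriv J ρ s → HasTrace J ρ h →
      ‖ρ‖ ^ 2 ≤ C * (‖s + A ρ‖ ^ 2 + ‖h‖ ^ 2) := by
  set μ := Real.exp (-(2 * β) * T) with hμ
  have hμ0 : 0 < μ := Real.exp_pos _
  set κ := μ * α with hκ
  have hκ0 : 0 < κ := mul_pos hμ0 hα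
  refine ⟨1 / κ + (1 / κ) ^ 2, by positivity, fun ρ s h hd hh => ?_⟩
  obtain ⟨c, h1, h2, -, h4⟩ := hd.exists_representative hJ hT
  have e : h = c 0 := hh.unique hT ⟨c, h1, h2, rfl⟩
  set f := s + A ρ with hf
  have h5 := h4 _ (contDiff_exp_mul (-(2 * β)))
  simp only [deriv_exp_mul, mul_zero, Real.exp_zero, one_mul] at h5
  have i1 := lp_integrable_norm_sq ρ
  have i2 := lp_integrable_norm_sq f
  have key : ∫ t, (-(2 * β) * Real.exp (-(2 * β) * t) * ‖J (ρ t)‖ ^ 2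
      + Real.exp (-(2 * β) * t) * (2 * inner ℝ (ρ t) (s t))) ∂edge T
      ≤ ∫ t, (1 / κ * ‖f t‖ ^ 2 - κ * ‖ρ t‖ ^ 2) ∂edge T := by
    refine integral_mono_ae ?_ ((i2.const_mul _).sub (i1.const_mul _)) ?_
    · refine Integrable.add ?_ ?_
      · exact integrable_bilin_right (ContinuousLinearMap.lsmul ℝ ℝ)
          (X := fun t => -(2 * β) * Real.exp (-(2 * β) * t)) (by fun_prop)
          (integrable_norm_sq (memLp_clm J (Lp.memLp ρ)))
      · exact integrable_bilin_right (ContinuousLinearMap.lsmul ℝ ℝ)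
          (contDiff_exp_mul _).continuous.continuousOn
          ((integrable_inner (Lp.memLp ρ) (Lp.memLp s)).const_mul 2)
    · filter_upwards [hA ρ, Lp.coeFn_add s (A ρ), ae_restrict_mem measurableSet_Ioo]
        with t a1 a2 ht
      have a3 : f t = s t + A ρ t := a2
      have a4 : inner ℝ (ρ t) (s t) = inner ℝ (ρ t) (f t) - inner ℝ (A ρ t) (ρ t) := by
        rw [a3, inner_add_right, real_inner_comm (ρ t) (A ρ t)]; ring
      set m := Real.exp (-(2 * β) * t) with hm
      have m1 : m ≤ 1 := by
        rw [hm, Real.exp_le_one_iff]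
        have := mul_nonneg hβ ht.1.le
        linarith
      have m2 : μ ≤ m := by
        rw [hm, hμ, Real.exp_le_exp]
        have := mul_le_mul_of_nonneg_left ht.2.le hβ
        linarith
      have m0 : 0 < m := Real.exp_pos _
      have b1 : m * (2 * inner ℝ (ρ t) (f t)) ≤ 2 * (‖ρ t‖ * ‖f t‖) := by
        have q := real_inner_le_norm (ρ t) (f t)
        calc m * (2 * inner ℝ (ρ t) (f t)) ≤ m * (2 * (‖ρ t‖ * ‖f t‖)) := by gcongr
          _ ≤ 1 * (2 * (‖ρ t‖ * ‖f t‖)) := by gcongr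
          _ = _ := one_mul _
      have b2 : 2 * (‖ρ t‖ * ‖f t‖) ≤ κ * ‖ρ t‖ ^ 2 + 1 / κ * ‖f t‖ ^ 2 := by
        have q : 0 ≤ 1 / κ * (κ * ‖ρ t‖ - ‖f t‖) ^ 2 := by positivity
        have q2 : 1 / κ * (κ * ‖ρ t‖ - ‖f t‖) ^ 2
            = κ * ‖ρ t‖ ^ 2 + 1 / κ * ‖f t‖ ^ 2 - 2 * (‖ρ t‖ * ‖f t‖) := by
          field_simp; ring
        linarith
      have b3 : κ * ‖ρ t‖ ^ 2 ≤ m * (α * ‖ρ t‖ ^ 2) := by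
        rw [hκ, mul_assoc]; gcongr
      have b4 := mul_le_mul_of_nonneg_left a1 m0.le
      rw [a4]
      nlinarith
  rw [integral_sub (i2.const_mul _) (i1.const_mul _), integral_const_mul, integral_const_mul,
    ← lp_norm_sq, ← lp_norm_sq] at key
  have h6 : 0 ≤ μ * ‖c T‖ ^ 2 := by positivity
  have h7 : κ * ‖ρ‖ ^ 2 ≤ 1 / κ * ‖f‖ ^ 2 + ‖h‖ ^ 2 := by
    rw [e]; linarith
  have h8 : ‖ρ‖ ^ 2 ≤ 1 / κ * (1 / κ * ‖f‖ ^ 2 + ‖h‖ ^ 2) := by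
    rw [one_div_mul_eq_div, le_div_iff₀ hκ0]; linarith
  have h9 : 0 < 1 / κ := by positivity
  nlinarith [sq_nonneg ‖f‖, sq_nonneg ‖h‖, mul_nonneg h9.le (sq_nonneg ‖f‖),
    mul_nonneg (sq_nonneg (1 / κ)) (sq_nonneg ‖h‖)]

/-- The data `(f, h)` for which `s + A ρ = f`, `ρ(0) = h` has a solution. -/
def solvableData (J : V →L[ℝ] H) (A : Lp V 2 (edge T) →L[ℝ] Lp V 2 (edge T)) :
    Submodule ℝ (WithLp 2 (Lp V 2 (edge T) × H)) where
  carrier := {p | ∃ ρ s, IsRieszTimeDeriv J ρ s ∧ HasTrace J ρ p.snd ∧ s + A ρ = p.fst}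
  zero_mem' := by
    refine ⟨0, 0, ⟨0, ?_⟩, ⟨fun _ => 0, continuousOn_const, ?_, rfl⟩, by simp⟩
    · filter_upwards [Lp.coeFn_zero V 2 (edge T), ae_restrict_mem measurableSet_Ioo] with t ht htI
      have : ∫ τ in (0 : ℝ)..t, (0 : Lp V 2 (edge T)) τ = 0 := by
        refine intervalIntegral.integral_zero_ae ?_
        filter_upwards [(ae_restrict_iff' measurableSet_Ioo).1 (Lp.coeFn_zero V 2 (edge T))]
          with τ hτ hτ'
        rw [uIoc_of_le htI.1.le] at hτ'
        exact hτ ⟨hτ'.1, hτ'.2.trans_lt htI.2⟩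
      rw [ht, this, Pi.zero_apply, map_zero, zero_add]
    · filter_upwards [Lp.coeFn_zero V 2 (edge T)] with t ht
      rw [ht, Pi.zero_apply, map_zero]
  add_mem' := by
    rintro p q ⟨ρ, s, h1, h2, h3⟩ ⟨ρ', s', h1', h2', h3'⟩
    refine ⟨ρ + ρ', s + s', h1.add h1', h2.add h2', ?_⟩
    rw [WithLp.add_fst, ← h3, ← h3', map_add]
    abel
  smul_mem' := by
    rintro r p ⟨ρ, s, h1, h2, h3⟩
    refine ⟨r • ρ, r • s, h1.smul r, h2.smul r, ?_⟩
    rw [WithLp.smul_fst, ← h3, map_smul, smul_add]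

theorem IsRieszTimeDeriv.sub {J : V →L[ℝ] H} {ρ ρ' s s' : Lp V 2 (edge T)}
    (h : IsRieszTimeDeriv J ρ s) (h' : IsRieszTimeDeriv J ρ' s') :
    IsRieszTimeDeriv J (ρ - ρ') (s - s') := by
  simpa [sub_eq_add_neg] using h.add (h'.smul (-1))

theorem cauchySeq_of_norm_sq_le {E F : Type*} [NormedAddCommGroup E] [NormedAddCommGroup F] {C : ℝ}
    (hC : 0 ≤ C) {x : ℕ → E} {y : ℕ → F} (hy : CauchySeq y)
    (h : ∀ m n, ‖x m - x n‖ ^ 2 ≤ C * ‖y m - y n‖ ^ 2) : CauchySeq x := by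
  rw [Metric.cauchySeq_iff] at hy ⊢
  intro ε hε
  obtain ⟨N, hN⟩ := hy (ε / (√C + 1)) (by positivity)
  refine ⟨N, fun m hm n hn => ?_⟩
  have h3 := hN m hm n hn
  rw [dist_eq_norm, lt_div_iff₀ (by positivity)] at h3
  rw [dist_eq_norm]
  have h4 : ‖x m - x n‖ ≤ √C * ‖y m - y n‖ := by
    refine le_of_sq_le_sq ?_ (by positivity)
    rw [mul_pow, Real.sq_sqrt hC]
    exact h m n
  nlinarith [norm_nonneg (y m - y n)]

/-- By the a priori estimate, solutions converge when their data do. -/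
theorem exists_solution_of_tendsto (J : V →L[ℝ] H) (hJ : Function.Injective J) (hT : 0 < T)
    {A : Lp V 2 (edge T) →L[ℝ] Lp V 2 (edge T)} {α β : ℝ} (hα : 0 < α) (hβ : 0 ≤ β)
    (hA : IsGarding J A α β) {ρ s f : ℕ → Lp V 2 (edge T)} {h : ℕ → H}
    (hd : ∀ n, IsRieszTimeDeriv J (ρ n) (s n)) (ht : ∀ n, HasTrace J (ρ n) (h n))
    (hf : ∀ n, s n + A (ρ n) = f n) {f' : Lp V 2 (edge T)} {h' : H}
    (hf' : Tendsto f atTop (𝓝 f')) (hh' : Tendsto h atTop (𝓝 h')) :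
    ∃ ρ' s', IsRieszTimeDeriv J ρ' s' ∧ HasTrace J ρ' h' ∧ s' + A ρ' = f' := by
  obtain ⟨C, hC0, hC⟩ := exists_apriori_bound J hJ hT hα hβ hA
  obtain ⟨C', hC'0, hC'⟩ := exists_trace_bound (T := T) J hJ hT
  have hρc : CauchySeq ρ := by
    refine cauchySeq_of_norm_sq_le (C := C * 2) (by positivity)
      (hf'.prodMk_nhds hh').cauchySeq fun m n => ?_
    have h1 := hC _ _ _ ((hd m).sub (hd n)) ((ht m).sub (ht n))
    have h2 : s m - s n + A (ρ m - ρ n) = f m - f n := by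
      rw [← hf, ← hf, map_sub]; abel
    rw [h2] at h1
    refine h1.trans ?_
    rw [mul_assoc, two_mul]
    have h3 := norm_fst_le ((f m, h m) - (f n, h n))
    have h4 := norm_snd_le ((f m, h m) - (f n, h n))
    rw [Prod.fst_sub] at h3
    rw [Prod.snd_sub] at h4
    gcongr
  obtain ⟨ρ', hρ'⟩ := cauchySeq_tendsto_of_complete hρc
  have hs' : Tendsto s atTop (𝓝 (f' - A ρ')) := by
    refine (hf'.sub ((A.continuous.tendsto _).comp hρ')).congr fun n => ?_
    rw [← hf, Function.comp_apply, add_sub_cancel_right]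
  have hd' : IsRieszTimeDeriv J ρ' (f' - A ρ') :=
    .of_tendsto hT hd hρ' hs'
  obtain ⟨k, hk⟩ := hd'.exists_hasTrace hJ hT
  refine ⟨ρ', f' - A ρ', hd', ?_, sub_add_cancel _ _⟩
  suffices hlk : Tendsto h atTop (𝓝 k) by rwa [tendsto_nhds_unique hh' hlk]
  rw [tendsto_iff_norm_sub_tendsto_zero]
  have hlim : Tendsto (fun n => √(C' * (‖ρ n - ρ'‖ ^ 2 + ‖s n - (f' - A ρ')‖ ^ 2))) atTop
      (𝓝 0) := by
    have h1 := (tendsto_iff_norm_sub_tendsto_zero.1 hρ').pow 2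
    have h2 := (tendsto_iff_norm_sub_tendsto_zero.1 hs').pow 2
    simpa using ((h1.add h2).const_mul C').sqrt
  refine squeeze_zero (fun n => norm_nonneg _) (fun n => ?_) hlim
  exact Real.le_sqrt_of_sq_le (hC' _ _ _ ((hd n).sub hd') ((ht n).sub hk))

theorem isClosed_solvableData (J : V →L[ℝ] H) (hJ : Function.Injective J) (hT : 0 < T)
    {A : Lp V 2 (edge T) →L[ℝ] Lp V 2 (edge T)} {α β : ℝ} (hα : 0 < α) (hβ : 0 ≤ β)
    (hA : IsGarding J A α β) :
    IsClosed (solvableData J A : Set (WithLp 2 (Lp V 2 (edge T) × H))) := by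
  refine isClosed_of_closure_subset fun p hp => ?_
  obtain ⟨q, hq, hqp⟩ := mem_closure_iff_seq_limit.1 hp
  choose ρ s hd ht hf using hq
  exact exists_solution_of_tendsto J hJ hT hα hβ hA hd ht hf
    (((WithLp.fstL 2 ℝ (Lp V 2 (edge T)) H).continuous.tendsto p).comp hqp)
    (((WithLp.sndL 2 ℝ (Lp V 2 (edge T)) H).continuous.tendsto p).comp hqp)

theorem isRieszTimeDeriv_smulConst (J : V →L[ℝ] H) {θ : ℝ → ℝ} (hθ : ContDiff ℝ 1 θ) (φ : V) :
    IsRieszTimeDeriv J (smulConst T hθ.continuous φ)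
      (smulConst T (hθ.continuous_deriv le_rfl) (gram J φ)) := by
  refine ⟨θ 0 • gram J φ, ?_⟩
  have h2 := (ae_restrict_iff' measurableSet_Ioo).1
    (coeFn_smulConst T (hθ.continuous_deriv le_rfl) (gram J φ))
  filter_upwards [coeFn_smulConst T hθ.continuous φ, ae_restrict_mem measurableSet_Ioo]
    with t ht htI
  rw [ht, map_smul, eq_primitive_deriv hθ t, add_smul, ← intervalIntegral.integral_smul_const]
  congr 1
  refine intervalIntegral.integral_congr_ae ?_
  filter_upwards [h2] with τ hτ hτ'
  rw [uIoc_of_le htI.1.le] at hτ'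
  exact (hτ ⟨hτ'.1, hτ'.2.trans_lt htI.2⟩).symm

theorem inner_smulConst {θ : ℝ → ℝ} (hθ : Continuous θ) (φ : V) (g : Lp V 2 (edge T)) :
    inner ℝ (smulConst T hθ φ) g = inner ℝ φ (∫ t, θ t • g t ∂edge T) := by
  rw [L2.inner_def, ← integral_inner (integrable_smul_lp
    (memLp_edge_of_continuousOn hθ.continuousOn 2) g)]
  refine integral_congr_ae ?_
  filter_upwards [coeFn_smulConst T hθ φ] with t ht
  rw [ht, real_inner_smul_left, real_inner_smul_right]

/-- A functional that vanishes on the solvable data is given by a solution of the adjoint equation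
with homogeneous data, hence is zero. -/
theorem solvableData_eq_top (J : V →L[ℝ] H) (hJ : Function.Injective J) (hJd : DenseRange J)
    (hT : 0 < T) {A : Lp V 2 (edge T) →L[ℝ] Lp V 2 (edge T)} {α β : ℝ} (hα : 0 < α) (hβ : 0 ≤ β)
    (hA : IsGarding J A α β) : solvableData J A = ⊤ := by
  rw [← (isClosed_solvableData J hJ hT hα hβ hA).submodule_topologicalClosure_eq,
    Submodule.topologicalClosure_eq_top_iff, Submodule.eq_bot_iff]
  intro p hp
  set g := p.fst with hg
  set r := A.adjoint g with hr
  have hadj : ∀ v, inner ℝ (A v) g = inner ℝ v r := fun v =>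
    (ContinuousLinearMap.adjoint_inner_right A v g).symm
  have hgi := lp_integrable g
  have hri := lp_integrable r
  have hBg : Integrable (fun t => gram J (g t)) (edge T) := (gram J).integrable_comp hgi
  -- orthogonality to the solvable data, tested with `θ(t) φ`
  have horth : ∀ θ : ℝ → ℝ, ContDiff ℝ 1 θ →
      (∫ t, (deriv θ t • gram J (g t) + θ t • r t) ∂edge T) + θ 0 • J.adjoint p.snd = 0 := by
    intro θ hθ
    have hθd := hθ.continuous_deriv le_rfl
    have i1 : Integrable (fun t => deriv θ t • gram J (g t)) (edge T) :=
      integrable_bilin_right (ContinuousLinearMap.lsmul ℝ ℝ) hθd.continuousOn hBg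
    have i1' : Integrable (fun t => deriv θ t • g t) (edge T) :=
      integrable_bilin_right (ContinuousLinearMap.lsmul ℝ ℝ) hθd.continuousOn hgi
    have i2 : Integrable (fun t => θ t • r t) (edge T) :=
      integrable_bilin_right (ContinuousLinearMap.lsmul ℝ ℝ) hθ.continuous.continuousOn hri
    refine ext_inner_left ℝ fun φ => ?_
    have h := hp (WithLp.toLp 2 (smulConst T hθd (gram J φ) + A (smulConst T hθ.continuous φ),
      θ 0 • J φ)) ⟨_, _, isRieszTimeDeriv_smulConst J hθ φ, hasTrace_smulConst J hθ.continuous φ,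
        rfl⟩
    rw [WithLp.prod_inner_apply] at h
    change inner ℝ (smulConst T hθd (gram J φ) + A (smulConst T hθ.continuous φ)) g
      + inner ℝ (θ 0 • J φ) p.snd = 0 at h
    rw [inner_add_left, inner_smulConst, hadj,
      inner_smulConst, real_inner_smul_left, ← ContinuousLinearMap.adjoint_inner_right J,
      inner_gram_left, ← inner_gram_right, ← (gram J).integral_comp_comm i1'] at h
    simp only [map_smul] at h
    rw [integral_add i1 i2, inner_add_right, inner_add_right, real_inner_smul_right,
      inner_zero_right]
    exact h
  have hd : IsRieszTimeDeriv J g r := by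
    rw [isRieszTimeDeriv_iff hT]
    intro θ hθ
    have h := horth θ (hθ.1.of_le (by simp))
    have h0 : θ 0 = 0 := image_eq_zero_of_notMem_tsupport fun h => (hθ.2.2 h).1.ne rfl
    rw [h0, zero_smul, add_zero, integral_add] at h
    · exact eq_neg_of_add_eq_zero_left h
    · exact integrable_bilin_right (ContinuousLinearMap.lsmul ℝ ℝ)
        (hθ.1.continuous_deriv (by simp)).continuousOn hBg
    · exact integrable_bilin_right (ContinuousLinearMap.lsmul ℝ ℝ) hθ.1.continuous.continuousOn hri
  obtain ⟨c, -, hc2, hc3, hc4⟩ := hd.exists_representative hJ hT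
  -- integration by parts identifies the boundary values of `g`
  have hbdry : ∀ θ : ℝ → ℝ, ContDiff ℝ 1 θ →
      θ T • J.adjoint (c T) = θ 0 • J.adjoint (c 0) - θ 0 • J.adjoint p.snd := by
    intro θ hθ
    have h := integral_deriv_smul_add hT.le hθ (Y := fun t => J.adjoint (c t)) hri hc3
    have e : ∫ t, (deriv θ t • J.adjoint (c t) + θ t • r t) ∂edge T
        = ∫ t, (deriv θ t • gram J (g t) + θ t • r t) ∂edge T := by
      refine integral_congr_ae ?_
      filter_upwards [hc2] with t ht
      rw [gram_apply, ht]
    rw [e, eq_neg_of_add_eq_zero_left (horth θ hθ)] at h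
    rw [h, sub_eq_add_neg]
  have hinj := adjoint_injective_of_denseRange hJd
  have hcT : c T = 0 := by
    have h := hbdry (fun t => t) contDiff_id
    rw [zero_smul, zero_smul, sub_zero, smul_eq_zero] at h
    exact hinj (by rw [h.resolve_left hT.ne', map_zero])
  have hc0 : c 0 = p.snd := by
    have h := hbdry (fun _ => 1) contDiff_const
    rw [hcT, map_zero, smul_zero, one_smul, one_smul] at h
    exact hinj (sub_eq_zero.1 h.symm)
  have hen := hc4 _ (contDiff_exp_mul (2 * β))
  simp only [deriv_exp_mul, mul_zero, Real.exp_zero, one_mul, hcT, norm_zero, ne_eq,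
    OfNat.ofNat_ne_zero, not_false_eq_true, zero_pow] at hen
  -- the Gårding inequality for the weighted function `exp (2βt) g`
  have hmc : Continuous fun t : ℝ => Real.exp (2 * β * t) := by fun_prop
  have hmg : MemLp (fun t => Real.exp (2 * β * t) • g t) 2 (edge T) := by
    obtain ⟨M, hM0, hM⟩ := exists_bound_of_continuousOn (T := T) hmc.continuousOn
    refine ((Lp.memLp g).const_smul M).mono (hmc.aestronglyMeasurable.smul (Lp.memLp g).1) ?_
    filter_upwards [ae_restrict_mem measurableSet_Ioo] with t ht
    rw [Pi.smul_apply, norm_smul, norm_smul]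
    have := (hM t (Ioo_subset_Icc_self ht)).trans (le_abs_self M)
    rw [Real.norm_eq_abs M]
    gcongr
  set G : Lp V 2 (edge T) := hmg.toLp with hG
  have hGae : ∀ᵐ t ∂edge T, G t = Real.exp (2 * β * t) • g t := hmg.coeFn_toLp
  have i1 : Integrable (fun t => Real.exp (2 * β * t) * inner ℝ (g t) (r t)) (edge T) :=
    integrable_bilin_right (ContinuousLinearMap.lsmul ℝ ℝ) hmc.continuousOn
      (integrable_inner (Lp.memLp g) (Lp.memLp r))
  have i2 : Integrable (fun t => 2 * β * Real.exp (2 * β * t) * ‖J (g t)‖ ^ 2) (edge T) :=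
    integrable_bilin_right (ContinuousLinearMap.lsmul ℝ ℝ)
      (X := fun t => 2 * β * Real.exp (2 * β * t)) (by fun_prop)
      (integrable_norm_sq (memLp_clm J (Lp.memLp g)))
  have i3 : Integrable (fun t => Real.exp (2 * β * t) * ‖J (g t)‖ ^ 2) (edge T) :=
    integrable_bilin_right (ContinuousLinearMap.lsmul ℝ ℝ) hmc.continuousOn
      (integrable_norm_sq (memLp_clm J (Lp.memLp g)))
  have i4 : Integrable (fun t => Real.exp (2 * β * t) * ‖g t‖ ^ 2) (edge T) :=
    integrable_bilin_right (ContinuousLinearMap.lsmul ℝ ℝ) hmc.continuousOn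
      (lp_integrable_norm_sq g)
  have hAG : ∫ t, Real.exp (2 * β * t) * inner ℝ (g t) (r t) ∂edge T
      = ∫ t, inner ℝ (A G t) (g t) ∂edge T := by
    rw [← L2.inner_def, hadj, L2.inner_def]
    refine integral_congr_ae ?_
    filter_upwards [hGae] with t ht
    rw [ht, real_inner_smul_left]
  have hlow : ∫ t, (α * (Real.exp (2 * β * t) * ‖g t‖ ^ 2)
      - β * (Real.exp (2 * β * t) * ‖J (g t)‖ ^ 2)) ∂edge T
      ≤ ∫ t, inner ℝ (A G t) (g t) ∂edge T := by
    refine integral_mono_ae ((i4.const_mul _).sub (i3.const_mul _))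
      (integrable_inner (Lp.memLp _) (Lp.memLp _)) ?_
    filter_upwards [hA G, hGae] with t h1 h2
    rw [h2, map_smul, norm_smul, norm_smul, real_inner_smul_right,
      Real.norm_of_nonneg (Real.exp_pos _).le] at h1
    refine le_of_mul_le_mul_left ?_ (Real.exp_pos (2 * β * t))
    refine le_trans (le_of_eq ?_) h1
    ring
  rw [integral_sub (i4.const_mul _) (i3.const_mul _), integral_const_mul,
    integral_const_mul] at hlow
  have hen2 : ∫ t, (2 * β * Real.exp (2 * β * t) * ‖J (g t)‖ ^ 2
      + Real.exp (2 * β * t) * (2 * inner ℝ (g t) (r t))) ∂edge T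
      = 2 * β * (∫ t, Real.exp (2 * β * t) * ‖J (g t)‖ ^ 2 ∂edge T)
        + 2 * ∫ t, Real.exp (2 * β * t) * inner ℝ (g t) (r t) ∂edge T := by
    rw [← integral_const_mul, ← integral_const_mul, ← integral_add (i3.const_mul _)
      (i1.const_mul _)]
    congr 1
    ext t
    ring
  rw [hen2, hAG] at hen
  have hpos : 0 ≤ ∫ t, Real.exp (2 * β * t) * ‖g t‖ ^ 2 ∂edge T :=
    integral_nonneg fun t => by positivity
  have hlow2 : ‖g‖ ^ 2 ≤ ∫ t, Real.exp (2 * β * t) * ‖g t‖ ^ 2 ∂edge T := by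
    rw [lp_norm_sq]
    refine setIntegral_mono_on (lp_integrable_norm_sq g) i4 measurableSet_Ioo fun t ht => ?_
    have : 1 ≤ Real.exp (2 * β * t) := Real.one_le_exp (by have := ht.1; positivity)
    nlinarith [sq_nonneg ‖g t‖]
  have h1 : ‖c 0‖ ^ 2 = 0 := by
    nlinarith [sq_nonneg ‖c 0‖, mul_nonneg hα.le hpos]
  have h2 : ‖g‖ ^ 2 = 0 := by
    have q : α * ∫ t, Real.exp (2 * β * t) * ‖g t‖ ^ 2 ∂edge T ≤ 0 := by
      nlinarith [sq_nonneg ‖c 0‖]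
    have q2 : ∫ t, Real.exp (2 * β * t) * ‖g t‖ ^ 2 ∂edge T ≤ 0 := by
      by_contra hn
      exact absurd q (not_le.2 (mul_pos hα (not_le.1 hn)))
    nlinarith [sq_nonneg ‖g‖]
  have hg0 : p.fst = 0 := by simpa using h2
  have hh0 : p.snd = 0 := by rw [← hc0]; simpa using h1
  exact WithLp.ofLp_injective 2 (Prod.ext hg0 hh0)

/-- Lions' theorem: the linear parabolic problem `s + A ρ = f`, `ρ(0) = h` is solvable. -/
theorem exists_parabolic_solution (J : V →L[ℝ] H) (hJ : Function.Injective J) (hJd : DenseRange J)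
    (hT : 0 < T) {A : Lp V 2 (edge T) →L[ℝ] Lp V 2 (edge T)} {α β : ℝ} (hα : 0 < α) (hβ : 0 ≤ β)
    (hA : IsGarding J A α β) (f : Lp V 2 (edge T)) (h : H) :
    ∃ ρ s, IsRieszTimeDeriv J ρ s ∧ HasTrace J ρ h ∧ s + A ρ = f := by
  have : WithLp.toLp 2 (f, h) ∈ solvableData J A := by
    rw [solvableData_eq_top J hJ hJd hT hα hβ hA]; trivial
  exact this

end Parabolic

/-! ### The spaces `𝕍 ⊆ 𝕃²` on the star graph -/

section StarSpace

open Filter Topology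

theorem IsWeakDeriv.exists_primitive {L : ℝ} (hL : 0 < L) {f g : L2 L} (h : IsWeakDeriv L f g) :
    ∃ Y : ℝ → ℝ, (∀ᵐ x ∂edge L, f x = Y x) ∧
      ∀ x ∈ Icc 0 L, Y x = Y 0 + ∫ r in (0 : ℝ)..x, g r := by
  obtain ⟨a, ha⟩ := exists_ae_eq_primitive hL (lp_integrable f) (lp_integrable g) fun θ hθ => by
    simpa only [smul_eq_mul, mul_comm] using h θ hθ
  exact ⟨fun x => a + ∫ r in (0 : ℝ)..x, g r, ha, fun x _ => by simp⟩

/-- The trace at `L` of `f ∈ H¹(0, L)`, up to the factor `L`, as an `L²`-continuous expression in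
`f` and `f'`; the trace at `0` then follows from `∫ f'`. -/
theorem IsWeakDeriv.hasEndpointValues_iff {L : ℝ} (hL : 0 < L) {f g : L2 L}
    (h : IsWeakDeriv L f g) (a b : ℝ) : HasEndpointValues L f a b ↔
      (L * b = (∫ x, f x ∂edge L) + ∫ x, x * g x ∂edge L) ∧ b = a + ∫ x, g x ∂edge L := by
  obtain ⟨Y, hY, hYp⟩ := h.exists_primitive hL
  have hYc := continuousOn_of_eq_primitive (lp_integrable g) hYp
  have h0 : (0 : ℝ) ∈ Icc 0 L := ⟨le_rfl, hL.le⟩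
  have hLL : L ∈ Icc 0 L := ⟨hL.le, le_rfl⟩
  have e1 : L * Y L = (∫ x, f x ∂edge L) + ∫ x, x * g x ∂edge L := by
    have := integral_deriv_smul_add hL.le contDiff_id (lp_integrable g) hYp
    simp only [id_eq, smul_eq_mul, zero_mul, zero_add] at this
    rw [this, integral_congr_ae hY, ← integral_add (integrable_edge_of_continuousOn hYc)]
    · simp
    · exact integrable_bilin_right (ContinuousLinearMap.lsmul ℝ ℝ) continuousOn_id
        (lp_integrable g)
  have e2 : Y L = Y 0 + ∫ x, g x ∂edge L := by rw [integral_edge hL.le, hYp L hLL]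
  constructor
  · rintro ⟨F, hF, hf, rfl, rfl⟩
    have hE := eqOn_Icc_of_ae_eq hL hF hYc (by filter_upwards [hY, hf] with x h1 h2; rw [← h1, h2])
    rw [hE h0, hE hLL]
    exact ⟨e1, e2⟩
  · rintro ⟨h1, h2⟩
    rw [← e1] at h1
    have hb : Y L = b := (mul_left_cancel₀ hL.ne' h1).symm
    exact ⟨Y, hYc, hY, by linarith, hb⟩

variable {N : ℕ} {l : Fin N → ℝ}

/-- Membership in `𝕍` in terms of `L²`-continuous functionals of `φ` and `∂ₓφ`: vanishing traces at
the outer ends, and equal increments `∫ ∂ₓφᵢ`, which then means equal traces at the centre. -/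
theorem mem_VSub_iff (hl : ∀ i, 0 < l i) (φ : WithLp 2 (LL2 l × LL2 l)) :
    φ ∈ VSub l ↔ (∀ i, IsWeakDeriv (l i) (φ.fst i) (φ.snd i)) ∧
      (∀ i, (∫ x, φ.fst i x ∂edge (l i)) + ∫ x, x * φ.snd i x ∂edge (l i) = 0) ∧
      ∀ i j, ∫ x, φ.snd i x ∂edge (l i) = ∫ x, φ.snd j x ∂edge (l j) := by
  constructor
  · rintro ⟨h1, c, hc⟩
    have h2 := fun i => ((h1 i).hasEndpointValues_iff (hl i) c 0).1 (hc i)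
    refine ⟨h1, fun i => by rw [← (h2 i).1, mul_zero], fun i j => ?_⟩
    have := (h2 i).2
    have := (h2 j).2
    linarith
  · rintro ⟨h1, h2, h3⟩
    obtain ⟨c, hc⟩ : ∃ c : ℝ, ∀ i, 0 = c + ∫ x, φ.snd i x ∂edge (l i) := by
      rcases isEmpty_or_nonempty (Fin N) with h | ⟨⟨j⟩⟩
      · exact ⟨0, fun i => h.elim i⟩
      · exact ⟨-∫ x, φ.snd j x ∂edge (l j), fun i => by rw [h3 i j, neg_add_cancel]⟩
    exact ⟨h1, c, fun i => ((h1 i).hasEndpointValues_iff (hl i) c 0).2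
      ⟨by rw [h2 i, mul_zero], hc i⟩⟩

theorem isClosed_VSub (hl : ∀ i, 0 < l i) : IsClosed (VSub l : Set (WithLp 2 (LL2 l × LL2 l))) := by
  have e : (VSub l : Set (WithLp 2 (LL2 l × LL2 l))) = {φ |
      (∀ i, IsWeakDeriv (l i) (φ.fst i) (φ.snd i)) ∧
      (∀ i, (∫ x, φ.fst i x ∂edge (l i)) + ∫ x, x * φ.snd i x ∂edge (l i) = 0) ∧
      ∀ i j, ∫ x, φ.snd i x ∂edge (l i) = ∫ x, φ.snd j x ∂edge (l j)} :=
    Set.ext fun φ => mem_VSub_iff hl φ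
  have hfst : ∀ i, Continuous fun φ : WithLp 2 (LL2 l × LL2 l) => φ.fst i := fun i =>
    ((PiLp.proj 2 (𝕜 := ℝ) (fun i => L2 (l i)) i).comp
      (WithLp.fstL 2 ℝ (LL2 l) (LL2 l))).continuous
  have hsnd : ∀ i, Continuous fun φ : WithLp 2 (LL2 l × LL2 l) => φ.snd i := fun i =>
    ((PiLp.proj 2 (𝕜 := ℝ) (fun i => L2 (l i)) i).comp
      (WithLp.sndL 2 ℝ (LL2 l) (LL2 l))).continuous
  have hint : ∀ i {η : ℝ → ℝ}, MemLp η 2 (edge (l i)) →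
      Continuous fun f : L2 (l i) => ∫ x, f x * η x ∂edge (l i) := fun i η hη => by
    simpa only [smul_eq_mul, mul_comm] using continuous_integral_smul (E := ℝ) hη
  have hone : ∀ i, Continuous fun f : L2 (l i) => ∫ x, f x ∂edge (l i) := fun i => by
    simpa using hint i (memLp_const (1 : ℝ))
  have hid : ∀ i, Continuous fun f : L2 (l i) => ∫ x, x * f x ∂edge (l i) := fun i => by
    simpa only [mul_comm, id_eq] using hint i (memLp_edge_of_continuousOn continuousOn_id 2)
  rw [e]
  simp only [IsWeakDeriv, ofPred_and, ofPred_forall]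
  refine IsClosed.inter ?_ (IsClosed.inter ?_ ?_)
  · exact isClosed_iInter fun i => isClosed_iInter fun θ => isClosed_iInter fun hθ =>
      isClosed_eq ((hint i (hθ.memLp_deriv _)).comp (hfst i))
        ((hint i (hθ.memLp _)).comp (hsnd i)).neg
  · exact isClosed_iInter fun i => isClosed_eq
      (((hone i).comp (hfst i)).add ((hid i).comp (hsnd i))) continuous_const
  · exact isClosed_iInter fun i => isClosed_iInter fun j => isClosed_eq
      ((hone i).comp (hsnd i)) ((hone j).comp (hsnd j))

theorem completeSpace_V (hl : ∀ i, 0 < l i) : CompleteSpace (V l) :=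
  (isClosed_VSub hl).completeSpace_coe

theorem secondCountableTopology_V : SecondCountableTopology (V l) := by
  have : Fact ((2 : ℝ≥0∞) ≠ ⊤) := ⟨by simp⟩
  have h0 : ∀ i, SecondCountableTopology (L2 (l i)) := fun i => inferInstance
  have h1 : SecondCountableTopology (LL2 l) :=
    (PiLp.continuousLinearEquiv 2 ℝ fun i =>
      L2 (l i)).toHomeomorph.isEmbedding.secondCountableTopology
  have h2 : SecondCountableTopology (WithLp 2 (LL2 l × LL2 l)) :=
    (WithLp.prodContinuousLinearEquiv 2 ℝ (LL2 l)
      (LL2 l)).toHomeomorph.isEmbedding.secondCountableTopology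
  exact TopologicalSpace.Subtype.secondCountableTopology (VSub l : Set (WithLp 2 (LL2 l × LL2 l)))

theorem V.val_eq (φ : V l) : V.val φ = (φ : VSub l).1.fst := rfl

theorem V.norm_sq (φ : V l) : ‖φ‖ ^ 2 = ‖V.val φ‖ ^ 2 + ‖V.dx φ‖ ^ 2 :=
  WithLp.prod_norm_sq_eq_of_L2 (φ : VSub l).1

theorem injective_val : Function.Injective (V.val : V l →L[ℝ] LL2 l) := by
  rw [injective_iff_map_eq_zero]
  intro φ hφ
  have hsnd : V.dx φ = 0 := by
    ext1 i
    rw [PiLp.zero_apply, Lp.eq_zero_iff_ae_eq_zero]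
    refine ae_eq_zero_of_forall_isTest (lp_integrable _) fun θ hθ => ?_
    have h := φ.2.1 i θ hθ
    have h0 : (φ : VSub l).1.fst i = 0 := by rw [← V.val_eq, hφ]; rfl
    have h1 := IsWeakDeriv.zero (l i) θ hθ
    have h2 : ∫ x in Ioo 0 (l i), (0 : L2 (l i)) x * θ x = 0 := by
      refine (integral_congr_ae ?_).trans (integral_zero ℝ ℝ)
      filter_upwards [Lp.coeFn_zero ℝ 2 (edge (l i))] with x hx
      rw [hx, Pi.zero_apply, zero_mul]
    rw [h0, h1, h2, neg_inj] at h
    simp only [smul_eq_mul, mul_comm (θ _)]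
    exact h.symm
  have := V.norm_sq φ
  rw [hφ, hsnd] at this
  simpa using this

/-- A test function on one edge, extended by zero, as an element of `𝕍`. -/
theorem exists_V_of_isTest (hl : ∀ i, 0 < l i) (i : Fin N) {θ : ℝ → ℝ} (hθ : IsTest 0 (l i) θ) :
    ∃ φ : V l, V.val φ = WithLp.toLp 2 (Pi.single i (hθ.memLp (edge (l i))).toLp) := by
  have hw : IsWeakDeriv (l i) (hθ.memLp (edge (l i))).toLp (hθ.memLp_deriv (edge (l i))).toLp := by
    intro η hη
    have hd : Integrable (deriv θ) (edge (l i)) :=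
      integrable_edge_of_memLp (hθ.memLp_deriv (edge (l i)))
    have h := hη.integral_deriv_smul (hl i).le hd
      (fun t _ => eq_primitive_deriv (hθ.1.of_le (by simp)) t)
    have e1 : ∫ x in Ioo 0 (l i), ((hθ.memLp (edge (l i))).toLp : L2 (l i)) x * deriv η x
        = ∫ x in Ioo 0 (l i), deriv η x • θ x := by
      refine integral_congr_ae ?_
      filter_upwards [(hθ.memLp (edge (l i))).coeFn_toLp] with x hx
      rw [hx, smul_eq_mul, mul_comm]
    have e2 : ∫ x in Ioo 0 (l i), ((hθ.memLp_deriv (edge (l i))).toLp : L2 (l i)) x * η x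
        = ∫ x in Ioo 0 (l i), η x • deriv θ x := by
      refine integral_congr_ae ?_
      filter_upwards [(hθ.memLp_deriv (edge (l i))).coeFn_toLp] with x hx
      rw [hx, smul_eq_mul, mul_comm]
    rw [e1, e2, h]
  have he : HasEndpointValues (l i) (hθ.memLp (edge (l i))).toLp 0 0 :=
    ⟨θ, hθ.1.continuous.continuousOn, (hθ.memLp (edge (l i))).coeFn_toLp,
      image_eq_zero_of_notMem_tsupport fun h => (hθ.2.2 h).1.ne rfl,
      image_eq_zero_of_notMem_tsupport fun h => (hθ.2.2 h).2.ne rfl⟩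
  let p : WithLp 2 (LL2 l × LL2 l) :=
    WithLp.toLp 2 (WithLp.toLp 2 (Pi.single i (hθ.memLp (edge (l i))).toLp),
      WithLp.toLp 2 (Pi.single i (hθ.memLp_deriv (edge (l i))).toLp))
  have hp : p ∈ VSub l := by
    refine ⟨fun j => ?_, 0, fun j => ?_⟩
    · change IsWeakDeriv (l j)
        (Pi.single (M := fun i => L2 (l i)) i (hθ.memLp (edge (l i))).toLp j)
        (Pi.single (M := fun i => L2 (l i)) i (hθ.memLp_deriv (edge (l i))).toLp j)
      rcases eq_or_ne j i with rfl | hji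
      · rw [Pi.single_eq_same, Pi.single_eq_same]; exact hw
      · rw [Pi.single_eq_of_ne hji, Pi.single_eq_of_ne hji]; exact IsWeakDeriv.zero _
    · change HasEndpointValues (l j)
        (Pi.single (M := fun i => L2 (l i)) i (hθ.memLp (edge (l i))).toLp j) 0 0
      rcases eq_or_ne j i with rfl | hji
      · rw [Pi.single_eq_same]; exact he
      · rw [Pi.single_eq_of_ne hji]; exact HasEndpointValues.zero _
  exact ⟨⟨p, hp⟩, rfl⟩

theorem denseRange_val (hl : ∀ i, 0 < l i) : DenseRange (V.val : V l →L[ℝ] LL2 l) := by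
  have h : (LinearMap.range (V.val : V l →L[ℝ] LL2 l).toLinearMap).topologicalClosure = ⊤ := by
    rw [Submodule.topologicalClosure_eq_top_iff, Submodule.eq_bot_iff]
    intro h hh
    ext1 i
    rw [PiLp.zero_apply, Lp.eq_zero_iff_ae_eq_zero]
    refine ae_eq_zero_of_forall_isTest (lp_integrable _) fun θ hθ => ?_
    obtain ⟨φ, hφ⟩ := exists_V_of_isTest hl i hθ
    have h1 : inner ℝ (V.val φ) h = 0 := hh _ ⟨φ, rfl⟩
    rw [hφ, PiLp.inner_apply, Finset.sum_eq_single i, PiLp.toLp_apply, Pi.single_eq_same,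
      L2.inner_def] at h1
    · refine Eq.trans ?_ h1
      refine integral_congr_ae ?_
      filter_upwards [(hθ.memLp (edge (l i))).coeFn_toLp] with x hx
      rw [hx]
      simp [mul_comm]
    · intro j _ hji
      rw [PiLp.toLp_apply, Pi.single_eq_of_ne hji, inner_zero_left]
    · simp
  exact Submodule.dense_iff_topologicalClosure_eq_top.2 h

end StarSpace

/-! ### The form `𝓕[u]` as an operator on `L²(0, T; 𝕍)` -/

section Pettis

open Filter Topology

theorem measurable_of_measurable_dist {α β : Type*} [MeasurableSpace α] [PseudoMetricSpace β]
    [SecondCountableTopology β] [MeasurableSpace β] [BorelSpace β] {f : α → β}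
    (h : ∀ b, Measurable fun a => dist (f a) b) : Measurable f := by
  refine measurable_of_isOpen fun U hU => ?_
  rcases isEmpty_or_nonempty β with hβ | hβ
  · have : f ⁻¹' U = ∅ := Set.eq_empty_of_forall_notMem fun a _ => hβ.elim (f a)
    rw [this]; exact MeasurableSet.empty
  have e : f ⁻¹' U = ⋃ (n : ℕ) (q : ℚ) (_ : Metric.ball (TopologicalSpace.denseSeq β n) q ⊆ U),
      {a | dist (f a) (TopologicalSpace.denseSeq β n) < q} := by
    ext a
    simp only [mem_preimage, mem_iUnion]
    constructor
    · intro ha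
      obtain ⟨ε, hε, hb⟩ := Metric.isOpen_iff.1 hU _ ha
      obtain ⟨n, hn⟩ := (TopologicalSpace.denseRange_denseSeq β).exists_dist_lt (f a) (half_pos hε)
      obtain ⟨q, hq1, hq2⟩ := exists_rat_btwn hn
      refine ⟨n, q, fun x hx => hb ?_, hq1⟩
      rw [Metric.mem_ball] at hx ⊢
      calc dist x (f a) ≤ dist x (TopologicalSpace.denseSeq β n)
            + dist (f a) (TopologicalSpace.denseSeq β n) := dist_triangle_right _ _ _
        _ < ε := by linarith
    · rintro ⟨n, q, hq, ha⟩
      exact hq ha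
  rw [e]
  exact MeasurableSet.iUnion fun n => MeasurableSet.iUnion fun q => MeasurableSet.iUnion fun _ =>
    measurableSet_lt (h _) measurable_const

/-- Pettis' theorem in the dual of a separable Hilbert space: weak-star measurability implies strong
measurability. -/
theorem stronglyMeasurable_dual {α V : Type*} [MeasurableSpace α] [NormedAddCommGroup V]
    [InnerProductSpace ℝ V] [CompleteSpace V] [SecondCountableTopology V]
    {σ : α → StrongDual ℝ V} (h : ∀ φ, Measurable fun a => σ a φ) : StronglyMeasurable σ := by
  have : SecondCountableTopology (StrongDual ℝ V) :=
    (InnerProductSpace.toDual ℝ V).symm.toHomeomorph.isEmbedding.secondCountableTopology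
  borelize (StrongDual ℝ V)
  refine (measurable_of_measurable_dist fun τ => ?_).stronglyMeasurable
  refine measurable_of_Iic fun r => ?_
  by_cases hr : 0 ≤ r
  · have e : (fun a => dist (σ a) τ) ⁻¹' Iic r
        = ⋂ n : ℕ, {a | ‖σ a (TopologicalSpace.denseSeq V n) - τ (TopologicalSpace.denseSeq V n)‖
            ≤ r * ‖TopologicalSpace.denseSeq V n‖} := by
      ext a
      rw [mem_preimage, mem_Iic, mem_iInter, dist_eq_norm]
      constructor
      · intro ha n
        exact ((σ a - τ).le_opNorm _).trans (mul_le_mul_of_nonneg_right ha (norm_nonneg _))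
      · intro ha
        refine ContinuousLinearMap.opNorm_le_bound _ hr fun φ => ?_
        refine (TopologicalSpace.denseRange_denseSeq V).induction_on
          (p := fun φ => ‖(σ a - τ) φ‖ ≤ r * ‖φ‖) φ ?_ ha
        exact isClosed_le (by fun_prop) (by fun_prop)
    rw [e]
    exact MeasurableSet.iInter fun n => measurableSet_le
      ((h _).sub measurable_const).norm measurable_const
  · have e : (fun a => dist (σ a) τ) ⁻¹' Iic r = ∅ := by
      refine Set.eq_empty_of_forall_notMem fun a ha => hr ?_
      exact dist_nonneg.trans ha
    rw [e]; exact MeasurableSet.empty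

end Pettis

section Form

open Filter Topology

theorem memLp_bounded_mul {L M : ℝ} {w : ℝ → ℝ} (hw : Measurable w) (hM : ∀ x, ‖w x‖ ≤ M)
    (f : L2 L) : MemLp (fun x => w x * f x) 2 (edge L) := by
  refine ((Lp.memLp f).const_mul M).mono (hw.aestronglyMeasurable.mul (Lp.memLp f).1) ?_
  refine Eventually.of_forall fun x => ?_
  rw [norm_mul, norm_mul]
  have := (hM x).trans (le_abs_self M)
  rw [Real.norm_eq_abs M]
  gcongr

/-- Multiplication by a bounded measurable function on `L²(0, L)`. -/
def mulBounded (L : ℝ) {M : ℝ} {w : ℝ → ℝ} (hw : Measurable w) (hM : ∀ x, ‖w x‖ ≤ M) :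
    L2 L →L[ℝ] L2 L :=
  LinearMap.mkContinuous
    { toFun := fun f => (memLp_bounded_mul hw hM f).toLp
      map_add' := fun f g => by
        rw [← MemLp.toLp_add]
        refine MemLp.toLp_congr _ _ ?_
        filter_upwards [Lp.coeFn_add f g] with x hx
        rw [hx, Pi.add_apply, Pi.add_apply, mul_add]
      map_smul' := fun c f => by
        rw [RingHom.id_apply, ← MemLp.toLp_const_smul]
        refine MemLp.toLp_congr _ _ ?_
        filter_upwards [Lp.coeFn_smul c f] with x hx
        rw [hx, Pi.smul_apply, Pi.smul_apply, smul_eq_mul, smul_eq_mul, mul_left_comm] } M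
    fun f => by
      refine Lp.norm_le_mul_norm_of_ae_le_mul ?_
      filter_upwards [(memLp_bounded_mul hw hM f).coeFn_toLp] with x hx
      change ‖((memLp_bounded_mul hw hM f).toLp : L2 L) x‖ ≤ _
      rw [hx, norm_mul]
      gcongr
      exact hM x

theorem coeFn_mulBounded {L M : ℝ} {w : ℝ → ℝ} (hw : Measurable w) (hM : ∀ x, ‖w x‖ ≤ M)
    (f : L2 L) : ∀ᵐ x ∂edge L, mulBounded L hw hM f x = w x * f x :=
  (memLp_bounded_mul hw hM f).coeFn_toLp

theorem norm_mulBounded_le {L M : ℝ} {w : ℝ → ℝ} (hw : Measurable w) (hM : ∀ x, ‖w x‖ ≤ M)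
    (f : L2 L) : ‖mulBounded L hw hM f‖ ≤ M * ‖f‖ := by
  refine Lp.norm_le_mul_norm_of_ae_le_mul ?_
  filter_upwards [coeFn_mulBounded hw hM f] with x hx
  rw [hx, norm_mul]
  gcongr
  exact hM x

variable {N : ℕ} {l : Fin N → ℝ} {T : ℝ}

/-- The component `φ ↦ φᵢ`, `𝕍 → L²(0, lᵢ)`. -/
def valComp (i : Fin N) : V l →L[ℝ] L2 (l i) :=
  (PiLp.proj 2 (𝕜 := ℝ) (fun i => L2 (l i)) i).comp V.val

/-- The component `φ ↦ ∂ₓφᵢ`, `𝕍 → L²(0, lᵢ)`. -/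
def dxComp (i : Fin N) : V l →L[ℝ] L2 (l i) :=
  (PiLp.proj 2 (𝕜 := ℝ) (fun i => L2 (l i)) i).comp V.dx

theorem norm_valComp_le (i : Fin N) (φ : V l) : ‖valComp i φ‖ ≤ ‖φ‖ := by
  refine (PiLp.norm_apply_le (V.val φ) i).trans (le_of_sq_le_sq ?_ (norm_nonneg _))
  rw [V.norm_sq]
  nlinarith [sq_nonneg ‖V.dx φ‖]

theorem norm_dxComp_le (i : Fin N) (φ : V l) : ‖dxComp i φ‖ ≤ ‖φ‖ := by
  refine (PiLp.norm_apply_le (V.dx φ) i).trans (le_of_sq_le_sq ?_ (norm_nonneg _))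
  rw [V.norm_sq]
  nlinarith [sq_nonneg ‖V.val φ‖]

/-- The drift on the edge `i`, truncated at its essential supremum: a representative of `uᵢ` that is
bounded everywhere. -/
def drift (u : LLinf l T) (i : Fin N) (p : ℝ × ℝ) : ℝ := max (-‖u i‖) (min ‖u i‖ (u i p))

theorem measurable_drift (u : LLinf l T) (i : Fin N) : Measurable (drift u i) :=
  measurable_const.max (measurable_const.min (Lp.stronglyMeasurable (u i)).measurable)

theorem measurable_drift_left (u : LLinf l T) (i : Fin N) (t : ℝ) :
    Measurable fun x => drift u i (x, t) :=
  (measurable_drift u i).comp measurable_prodMk_right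

theorem norm_drift_le (u : LLinf l T) (i : Fin N) (p : ℝ × ℝ) : ‖drift u i p‖ ≤ ‖u i‖ := by
  rw [Real.norm_eq_abs, abs_le]
  exact ⟨le_max_left _ _, max_le (by linarith [norm_nonneg (u i)]) (min_le_left _ _)⟩

theorem edge_prod (i : Fin N) (T : ℝ) :
    (volume : Measure (ℝ × ℝ)).restrict (Ioo 0 (l i) ×ˢ Ioo 0 T) = (edge (l i)).prod (edge T) := by
  rw [Measure.prod_restrict, Measure.volume_eq_prod]

theorem ae_ae_of_ae_edge_prod {i : Fin N} {p : ℝ × ℝ → Prop}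
    (h : ∀ᵐ q ∂(volume : Measure (ℝ × ℝ)).restrict (Ioo 0 (l i) ×ˢ Ioo 0 T), p q) :
    ∀ᵐ t ∂edge T, ∀ᵐ x ∂edge (l i), p (x, t) := by
  rw [edge_prod] at h
  have h2 := (Measure.measurePreserving_swap (μ := edge T)
    (ν := edge (l i))).quasiMeasurePreserving.ae h
  exact Measure.ae_ae_of_ae_prod h2

theorem ae_drift_eq (u : LLinf l T) :
    ∀ᵐ t ∂edge T, ∀ i, ∀ᵐ x ∂edge (l i), u i (x, t) = drift u i (x, t) := by
  refine ae_all_iff.2 fun i => ae_ae_of_ae_edge_prod (l := l)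
    (p := fun q => u i q = drift u i q) ?_
  have h : ∀ᵐ q ∂(volume : Measure (ℝ × ℝ)).restrict (Ioo 0 (l i) ×ˢ Ioo 0 T),
      ‖u i q‖ ≤ ‖u i‖ := by
    filter_upwards [ae_le_eLpNormEssSup (f := u i)
      (μ := (volume : Measure (ℝ × ℝ)).restrict (Ioo 0 (l i) ×ˢ Ioo 0 T))] with q hq
    rw [Lp.norm_def, ← toReal_enorm, eLpNorm_exponent_top]
    refine ENNReal.toReal_mono ?_ hq
    rw [← eLpNorm_exponent_top]
    exact (Lp.memLp (u i)).2.ne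
  filter_upwards [h] with q hq
  rw [Real.norm_eq_abs, abs_le] at hq
  rw [drift, min_eq_right hq.2, max_eq_right hq.1]

/-- The bilinear form `𝓕[u(t)]` on `𝕍`, as a bounded operator `𝕍 → 𝕍*`. -/
def formOp (D : Fin N → ℝ) (u : LLinf l T) (t : ℝ) : V l →L[ℝ] VStar l :=
  ∑ i, (innerSL ℝ).bilinearComp
    (D i • dxComp i + (mulBounded (l i) (measurable_drift_left u i t)
      fun x => norm_drift_le u i (x, t)).comp (valComp i)) (dxComp i)

theorem formOp_apply (D : Fin N → ℝ) (u : LLinf l T) (t : ℝ) (ρ φ : V l) :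
    formOp D u t ρ φ = ∑ i, inner ℝ (D i • dxComp i ρ
      + mulBounded (l i) (measurable_drift_left u i t) (fun x => norm_drift_le u i (x, t))
        (valComp i ρ)) (dxComp i φ) := by
  simp only [formOp, sum_apply]
  rfl

theorem integral_mul_eq_inner {L : ℝ} (f g : L2 L) : inner ℝ f g = ∫ x, f x * g x ∂edge L := by
  rw [L2.inner_def]
  refine integral_congr_ae (Eventually.of_forall fun x => ?_)
  simp [mul_comm]

theorem formOp_eq_integral (D : Fin N → ℝ) (u : LLinf l T) (t : ℝ) (ρ φ : V l) :
    formOp D u t ρ φ = ∑ i, ∫ x in Ioo 0 (l i),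
      (D i * V.dx ρ i x + drift u i (x, t) * V.val ρ i x) * V.dx φ i x := by
  rw [formOp_apply]
  refine Finset.sum_congr rfl fun i _ => ?_
  rw [integral_mul_eq_inner]
  refine integral_congr_ae ?_
  filter_upwards [Lp.coeFn_add (D i • dxComp i ρ) (mulBounded (l i) (measurable_drift_left u i t)
    (fun x => norm_drift_le u i (x, t)) (valComp i ρ)), Lp.coeFn_smul (D i) (dxComp i ρ),
    coeFn_mulBounded (measurable_drift_left u i t) (fun x => norm_drift_le u i (x, t))
      (valComp i ρ)] with x h1 h2 h3
  rw [h1, Pi.add_apply, h2, h3]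
  rfl

theorem ae_form_eq_formOp (D : Fin N → ℝ) (u : LLinf l T) :
    ∀ᵐ t ∂edge T, ∀ ρ φ, form l D u t ρ φ = formOp D u t ρ φ := by
  filter_upwards [ae_drift_eq u] with t ht ρ φ
  rw [formOp_eq_integral, form]
  refine Finset.sum_congr rfl fun i _ => integral_congr_ae ?_
  filter_upwards [ht i] with x hx
  rw [hx]

theorem norm_formOp_apply_le (D : Fin N → ℝ) (u : LLinf l T) (t : ℝ) (ρ : V l) :
    ‖formOp D u t ρ‖ ≤ (∑ i, |D i| + ‖u‖) * ‖ρ‖ := by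
  refine ContinuousLinearMap.opNorm_le_bound _ (by positivity) fun φ => ?_
  rw [formOp_apply, PiLp.norm_eq_of_L1, ← Finset.sum_add_distrib, Finset.sum_mul, Finset.sum_mul]
  refine norm_sum_le_of_le _ fun i _ => (norm_inner_le_norm _ _).trans ?_
  refine mul_le_mul ?_ (norm_dxComp_le i φ) (norm_nonneg _) (by positivity)
  refine (norm_add_le _ _).trans ?_
  rw [norm_smul, Real.norm_eq_abs, add_mul]
  refine add_le_add (mul_le_mul_of_nonneg_left (norm_dxComp_le i ρ) (abs_nonneg _)) ?_
  exact (norm_mulBounded_le _ _ _).trans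
    (mul_le_mul_of_nonneg_left (norm_valComp_le i ρ) (norm_nonneg _))

/-- Gårding's inequality for `𝓕[u(t)]`, uniformly in `t`. -/
theorem exists_garding (D : Fin N → ℝ) (hD : ∀ i, 0 < D i) (u : LLinf l T) :
    ∃ α β : ℝ, 0 < α ∧ 0 ≤ β ∧ ∀ (t : ℝ) (ρ : V l),
      α * ‖ρ‖ ^ 2 - β * ‖V.val ρ‖ ^ 2 ≤ formOp D u t ρ ρ := by
  obtain ⟨δ, hδ, hδD⟩ : ∃ δ > 0, ∀ i, δ ≤ D i := by
    rcases isEmpty_or_nonempty (Fin N) with h | h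
    · exact ⟨1, one_pos, fun i => h.elim i⟩
    · obtain ⟨j, hj⟩ := Finite.exists_min D
      exact ⟨D j, hD j, hj⟩
  have hui : ∀ i, ‖u i‖ ≤ ‖u‖ := fun i => PiLp.norm_apply_le u i
  set M := ‖u‖ with hM
  refine ⟨δ / 2, M ^ 2 / (2 * δ) + δ / 2, by positivity, by positivity, fun t ρ => ?_⟩
  have hi : ∀ i, δ / 2 * ‖V.dx ρ i‖ ^ 2 - M ^ 2 / (2 * δ) * ‖V.val ρ i‖ ^ 2
      ≤ inner ℝ (D i • dxComp i ρ + mulBounded (l i) (measurable_drift_left u i t)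
        (fun x => norm_drift_le u i (x, t)) (valComp i ρ)) (dxComp i ρ) := by
    intro i
    rw [inner_add_left, real_inner_smul_left, real_inner_self_eq_norm_sq]
    have h1 := norm_inner_le_norm (𝕜 := ℝ) (mulBounded (l i) (measurable_drift_left u i t)
      (fun x => norm_drift_le u i (x, t)) (valComp i ρ)) (dxComp i ρ)
    have h2 := (norm_mulBounded_le (measurable_drift_left u i t)
      (fun x => norm_drift_le u i (x, t)) (valComp i ρ)).trans
      (mul_le_mul_of_nonneg_right (hui i) (norm_nonneg _))
    have h3 := (neg_abs_le _).trans' (neg_le_neg (h1.trans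
      (mul_le_mul_of_nonneg_right h2 (norm_nonneg (dxComp i ρ)))))
    change _ ≤ D i * ‖V.dx ρ i‖ ^ 2 + _
    change -(M * ‖V.val ρ i‖ * ‖V.dx ρ i‖) ≤ _ at h3
    have h4 : δ * ‖V.dx ρ i‖ ^ 2 ≤ D i * ‖V.dx ρ i‖ ^ 2 :=
      mul_le_mul_of_nonneg_right (hδD i) (sq_nonneg _)
    have h5 : 0 ≤ 1 / (2 * δ) * (δ * ‖V.dx ρ i‖ - M * ‖V.val ρ i‖) ^ 2 := by positivity
    have h6 : 1 / (2 * δ) * (δ * ‖V.dx ρ i‖ - M * ‖V.val ρ i‖) ^ 2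
        = δ / 2 * ‖V.dx ρ i‖ ^ 2 + M ^ 2 / (2 * δ) * ‖V.val ρ i‖ ^ 2
          - M * ‖V.val ρ i‖ * ‖V.dx ρ i‖ := by
      field_simp; ring
    linarith
  have hsum := Finset.sum_le_sum fun i (_ : i ∈ Finset.univ) => hi i
  rw [← formOp_apply, Finset.sum_sub_distrib, ← Finset.mul_sum, ← Finset.mul_sum,
    ← PiLp.norm_sq_eq_of_L2, ← PiLp.norm_sq_eq_of_L2] at hsum
  rw [V.norm_sq]
  linarith

theorem stronglyMeasurable_formOp (hl : ∀ i, 0 < l i) (D : Fin N → ℝ) (u : LLinf l T) (ρ : V l) :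
    StronglyMeasurable fun t => formOp D u t ρ := by
  have := completeSpace_V hl
  have := secondCountableTopology_V (l := l)
  refine stronglyMeasurable_dual fun φ => ?_
  simp only [formOp_eq_integral]
  refine Finset.measurable_sum _ fun i _ => ?_
  have hm : ∀ f : L2 (l i), Measurable fun p : ℝ × ℝ => f p.2 := fun f =>
    (Lp.stronglyMeasurable f).measurable.comp measurable_snd
  have h : Measurable fun p : ℝ × ℝ =>
      (D i * V.dx ρ i p.2 + drift u i (p.2, p.1) * V.val ρ i p.2) * V.dx φ i p.2 :=
    (((hm _).const_mul _).add (((measurable_drift u i).comp measurable_swap).mul (hm _))).mul (hm _)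
  exact (h.stronglyMeasurable.integral_prod_right' (ν := edge (l i))).measurable

/-- `t ↦ 𝓕[u(t)](ρ(t), ·)` is in `L²(0, T; 𝕍*)`: the map `(t, v) ↦ 𝓕[u(t)](v, ·)` is measurable in
`t` and continuous in `v`. -/
theorem memLp_formOp (hl : ∀ i, 0 < l i) (D : Fin N → ℝ) (u : LLinf l T) (ρ : L2V l T) :
    MemLp (fun t => formOp D u t (ρ t)) 2 (edge T) := by
  have := secondCountableTopology_V (l := l)
  borelize (V l)
  have h1 : StronglyMeasurable (Function.uncurry fun (v : V l) t => formOp D u t v) :=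
    stronglyMeasurable_uncurry_of_continuous_of_stronglyMeasurable
      (fun t => (formOp D u t).continuous) fun v => stronglyMeasurable_formOp hl D u v
  have h3 : Measurable fun t => (ρ t, t) :=
    (Lp.stronglyMeasurable ρ).measurable.prodMk measurable_id
  have h2 : AEStronglyMeasurable (fun t => formOp D u t (ρ t)) (edge T) :=
    (h1.comp_measurable h3).aestronglyMeasurable
  exact MemLp.of_le_mul (Lp.memLp ρ) h2
    (Eventually.of_forall fun t => norm_formOp_apply_le D u t (ρ t))

theorem isFormFunctional_toLp (hl : ∀ i, 0 < l i) (D : Fin N → ℝ) (u : LLinf l T) (ρ : L2V l T) :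
    IsFormFunctional l D u ρ (memLp_formOp hl D u ρ).toLp := by
  filter_upwards [(memLp_formOp hl D u ρ).coeFn_toLp, ae_form_eq_formOp D u] with t h1 h2 φ
  rw [h1, h2]

theorem IsFormFunctional.unique {D : Fin N → ℝ} {u : LLinf l T} {ρ : L2V l T} {f g : L2VStar l T}
    (hf : IsFormFunctional l D u ρ f) (hg : IsFormFunctional l D u ρ g) : f = g := by
  refine Lp.ext ?_
  filter_upwards [hf, hg] with t h1 h2
  ext φ
  rw [h1, h2]

theorem existsUnique_isFormFunctional (hl : ∀ i, 0 < l i) (D : Fin N → ℝ) (u : LLinf l T)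
    (ρ : L2V l T) : ∃! f, IsFormFunctional l D u ρ f :=
  ⟨_, isFormFunctional_toLp hl D u ρ, fun _ hf => hf.unique (isFormFunctional_toLp hl D u ρ)⟩

theorem formFunctional_spec (hl : ∀ i, 0 < l i) (D : Fin N → ℝ) (u : LLinf l T) (ρ : L2V l T) :
    IsFormFunctional l D u ρ (formFunctional l D u ρ) :=
  Classical.epsilon_spec (p := fun f => IsFormFunctional l D u ρ f)
    ⟨_, isFormFunctional_toLp hl D u ρ⟩

theorem formFunctional_ae (hl : ∀ i, 0 < l i) (D : Fin N → ℝ) (u : LLinf l T) (ρ : L2V l T) :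
    ∀ᵐ t ∂edge T, formFunctional l D u ρ t = formOp D u t (ρ t) := by
  filter_upwards [formFunctional_spec hl D u ρ, ae_form_eq_formOp D u] with t h1 h2
  ext φ
  rw [h1, h2]

theorem norm_formFunctional_le (hl : ∀ i, 0 < l i) (D : Fin N → ℝ) (u : LLinf l T) (ρ : L2V l T) :
    ‖formFunctional l D u ρ‖ ≤ (∑ i, |D i| + ‖u‖) * ‖ρ‖ := by
  refine Lp.norm_le_mul_norm_of_ae_le_mul ?_
  filter_upwards [formFunctional_ae hl D u ρ] with t ht
  rw [ht]
  exact norm_formOp_apply_le D u t (ρ t)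

theorem formFunctional_add_right (hl : ∀ i, 0 < l i) (D : Fin N → ℝ) (u : LLinf l T)
    (ρ ρ' : L2V l T) : formFunctional l D u (ρ + ρ')
      = formFunctional l D u ρ + formFunctional l D u ρ' := by
  refine Lp.ext ?_
  filter_upwards [formFunctional_ae hl D u ρ, formFunctional_ae hl D u ρ',
    formFunctional_ae hl D u (ρ + ρ'), Lp.coeFn_add ρ ρ', Lp.coeFn_add (formFunctional l D u ρ)
      (formFunctional l D u ρ')] with t h1 h2 h3 h4 h5
  rw [h3, h4, h5, Pi.add_apply, Pi.add_apply, map_add, h1, h2]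

theorem formFunctional_smul_right (hl : ∀ i, 0 < l i) (D : Fin N → ℝ) (u : LLinf l T)
    (c : ℝ) (ρ : L2V l T) : formFunctional l D u (c • ρ) = c • formFunctional l D u ρ := by
  refine Lp.ext ?_
  filter_upwards [formFunctional_ae hl D u ρ, formFunctional_ae hl D u (c • ρ),
    Lp.coeFn_smul c ρ, Lp.coeFn_smul c (formFunctional l D u ρ)] with t h1 h3 h4 h5
  rw [h3, h4, h5, Pi.smul_apply, Pi.smul_apply, map_smul, h1]

theorem integrable_formOp_term (D : ℝ) (u : LLinf l T) (i : Fin N) (t : ℝ) (ρ φ : V l) :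
    Integrable (fun x => (D * V.dx ρ i x + drift u i (x, t) * V.val ρ i x) * V.dx φ i x)
      (edge (l i)) :=
  (((Lp.memLp (V.dx ρ i)).const_mul D).add (memLp_bounded_mul (measurable_drift_left u i t)
    (fun x => norm_drift_le u i (x, t)) (V.val ρ i))).integrable_mul (Lp.memLp (V.dx φ i))

/-- `𝓕[u]` is jointly linear in the coefficients `(D, u)`. -/
theorem formFunctional_add_left (hl : ∀ i, 0 < l i) (D D' : Fin N → ℝ) (u u' : LLinf l T)
    (ρ : L2V l T) : formFunctional l (D + D') (u + u') ρ
      = formFunctional l D u ρ + formFunctional l D' u' ρ := by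
  have hu : ∀ᵐ t ∂edge T, ∀ i, ∀ᵐ x ∂edge (l i), (u + u') i (x, t) = u i (x, t) + u' i (x, t) :=
    ae_all_iff.2 fun i => ae_ae_of_ae_edge_prod (Lp.coeFn_add (u i) (u' i))
  refine Lp.ext ?_
  filter_upwards [formFunctional_ae hl D u ρ, formFunctional_ae hl D' u' ρ,
    formFunctional_ae hl (D + D') (u + u') ρ, Lp.coeFn_add (formFunctional l D u ρ)
      (formFunctional l D' u' ρ), hu, ae_drift_eq u, ae_drift_eq u', ae_drift_eq (u + u')]
    with t h1 h2 h3 h4 h5 h6 h7 h8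
  rw [h3, h4, Pi.add_apply, h1, h2]
  ext φ
  rw [add_apply, formOp_eq_integral, formOp_eq_integral, formOp_eq_integral,
    ← Finset.sum_add_distrib]
  refine Finset.sum_congr rfl fun i _ => ?_
  rw [← integral_add (integrable_formOp_term _ u i t _ _) (integrable_formOp_term _ u' i t _ _)]
  refine integral_congr_ae ?_
  filter_upwards [h5 i, h6 i, h7 i, h8 i] with x q1 q2 q3 q4
  rw [← q4, q1, q2, q3, Pi.add_apply]
  ring

theorem formFunctional_smul_left (hl : ∀ i, 0 < l i) (D : Fin N → ℝ) (c : ℝ) (u : LLinf l T)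
    (ρ : L2V l T) : formFunctional l (c • D) (c • u) ρ = c • formFunctional l D u ρ := by
  have hu : ∀ᵐ t ∂edge T, ∀ i, ∀ᵐ x ∂edge (l i), (c • u) i (x, t) = c * u i (x, t) :=
    ae_all_iff.2 fun i => ae_ae_of_ae_edge_prod (Lp.coeFn_smul c (u i))
  refine Lp.ext ?_
  filter_upwards [formFunctional_ae hl D u ρ,
    formFunctional_ae hl (c • D) (c • u) ρ, Lp.coeFn_smul c (formFunctional l D u ρ), hu,
    ae_drift_eq u, ae_drift_eq (c • u)] with t h1 h3 h4 h5 h6 h8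
  rw [h3, h4, Pi.smul_apply, h1]
  ext φ
  rw [smul_apply, formOp_eq_integral, formOp_eq_integral, Finset.smul_sum]
  refine Finset.sum_congr rfl fun i _ => ?_
  rw [← integral_smul]
  refine integral_congr_ae ?_
  filter_upwards [h5 i, h6 i, h8 i] with x q1 q2 q4
  rw [← q4, q1, q2, Pi.smul_apply, smul_eq_mul, smul_eq_mul]
  ring

end Form

/-! ### The state equation in `𝕎(0, T)` -/

section Riesz

variable {V H : Type*} [NormedAddCommGroup V] [InnerProductSpace ℝ V] [CompleteSpace V]
  [NormedAddCommGroup H] [InnerProductSpace ℝ H] [CompleteSpace H] {T : ℝ}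

/-- The Riesz isomorphism `V* → V` as a real-linear map. -/
def rieszInv (V : Type*) [NormedAddCommGroup V] [InnerProductSpace ℝ V] [CompleteSpace V] :
    StrongDual ℝ V →L[ℝ] V :=
  (InnerProductSpace.toDual ℝ V).symm.toContinuousLinearEquiv.toContinuousLinearMap

theorem inner_rieszInv (σ : StrongDual ℝ V) (v : V) : inner ℝ (rieszInv V σ) v = σ v :=
  InnerProductSpace.toDual_symm_apply

/-- The Riesz isomorphism applied pointwise, `L²(0, T; V*) → L²(0, T; V)`. -/
def rieszLp (V : Type*) [NormedAddCommGroup V] [InnerProductSpace ℝ V] [CompleteSpace V] (T : ℝ) :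
    Lp (StrongDual ℝ V) 2 (edge T) →L[ℝ] Lp V 2 (edge T) :=
  (rieszInv V).compLpL 2 (edge T)

theorem coeFn_rieszLp (σ : Lp (StrongDual ℝ V) 2 (edge T)) :
    ∀ᵐ t ∂edge T, rieszLp V T σ t = rieszInv V (σ t) :=
  (rieszInv V).coeFn_compLpL σ

theorem rieszLp_injective : Function.Injective (rieszLp V T) := by
  intro σ τ h
  refine Lp.ext ?_
  filter_upwards [coeFn_rieszLp σ, coeFn_rieszLp τ] with t h1 h2
  rw [h, h2] at h1
  ext v
  rw [← inner_rieszInv, ← inner_rieszInv, h1]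

theorem rieszLp_surjective : Function.Surjective (rieszLp V T) := by
  intro f
  let R : V →L[ℝ] StrongDual ℝ V := innerSL ℝ
  refine ⟨R.compLpL 2 (edge T) f, Lp.ext ?_⟩
  filter_upwards [coeFn_rieszLp (R.compLpL 2 (edge T) f), R.coeFn_compLpL (p := 2) f] with t h1 h2
  rw [h1, h2]
  refine ext_inner_right ℝ fun v => ?_
  rw [inner_rieszInv]
  rfl

/-- The distributional time derivative in `V*` corresponds to the one in `V` under the Riesz
isomorphism. -/
theorem isRieszTimeDeriv_rieszLp_iff (hT : 0 < T) (J : V →L[ℝ] H) (ρ : Lp V 2 (edge T))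
    (σ : Lp (StrongDual ℝ V) 2 (edge T)) :
    IsRieszTimeDeriv J ρ (rieszLp V T σ) ↔ ∀ θ : ℝ → ℝ, IsTest 0 T θ → ∀ φ : V,
      ∫ t in Ioo 0 T, deriv θ t * inner ℝ (J (ρ t)) (J φ) = -∫ t in Ioo 0 T, θ t * σ t φ := by
  rw [isRieszTimeDeriv_iff hT]
  refine forall_congr' fun θ => forall_congr' fun hθ => ?_
  have i1 : Integrable (fun t => deriv θ t • gram J (ρ t)) (edge T) :=
    integrable_bilin_right (ContinuousLinearMap.lsmul ℝ ℝ)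
      (hθ.1.continuous_deriv (by simp)).continuousOn ((gram J).integrable_comp (lp_integrable ρ))
  have i2 : Integrable (fun t => θ t • rieszLp V T σ t) (edge T) :=
    integrable_bilin_right (ContinuousLinearMap.lsmul ℝ ℝ) hθ.1.continuous.continuousOn
      (lp_integrable (rieszLp V T σ))
  have e1 : ∀ φ, inner ℝ φ (∫ t in Ioo 0 T, deriv θ t • gram J (ρ t))
      = ∫ t in Ioo 0 T, deriv θ t * inner ℝ (J (ρ t)) (J φ) := fun φ => by
    rw [← integral_inner i1]
    refine integral_congr_ae (Filter.Eventually.of_forall fun t => ?_)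
    beta_reduce
    rw [real_inner_smul_right, inner_gram_right, real_inner_comm]
  have e2 : ∀ φ, inner ℝ φ (-∫ t in Ioo 0 T, θ t • rieszLp V T σ t)
      = -∫ t in Ioo 0 T, θ t * σ t φ := fun φ => by
    rw [inner_neg_right, ← integral_inner i2]
    congr 1
    refine integral_congr_ae ?_
    filter_upwards [coeFn_rieszLp σ] with t ht
    rw [ht, real_inner_smul_right, real_inner_comm, inner_rieszInv]
  constructor
  · intro h φ
    rw [← e1, ← e2, h]
  · intro h
    refine ext_inner_left ℝ fun φ => ?_
    rw [e1, e2, h φ]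

end Riesz

/-- Solutions of a linear equation depend smoothly on a parameter when the operator does. -/
theorem contDiff_of_bijective {U W Z : Type*} [NormedAddCommGroup U] [NormedSpace ℝ U]
    [NormedAddCommGroup W] [NormedSpace ℝ W] [CompleteSpace W] [NormedAddCommGroup Z]
    [NormedSpace ℝ Z] [CompleteSpace Z] {S : U → W →L[ℝ] Z} (hS : ContDiff ℝ ∞ S)
    (hb : ∀ u, Function.Bijective (S u)) {z : Z} {G : U → W} (hG : ∀ u, S u (G u) = z) :
    ContDiff ℝ ∞ G := by
  let e : U → W ≃L[ℝ] Z := fun u => ContinuousLinearEquiv.ofBijective (S u)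
    (LinearMap.ker_eq_bot.2 (hb u).1) (LinearMap.range_eq_top.2 (hb u).2)
  have he : ∀ u, (e u : W →L[ℝ] Z) = S u := fun u => by
    ext w; rfl
  have hGe : G = fun u => ContinuousLinearMap.inverse (S u) z := by
    funext u
    rw [← he, ContinuousLinearMap.inverse_equiv, ← hG u]
    exact ((e u).symm_apply_apply (G u)).symm
  rw [hGe, contDiff_iff_contDiffAt]
  intro u
  have h1 : ContDiffAt ℝ ∞ (ContinuousLinearMap.inverse : (W →L[ℝ] Z) → Z →L[ℝ] W) (S u) := by
    rw [← he]
    exact contDiffAt_map_inverse (e u)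
  exact (h1.comp u hS.contDiffAt).clm_apply contDiffAt_const

section State

open Filter Topology

variable {N : ℕ} {l : Fin N → ℝ} {T : ℝ}

theorem W.isTimeDeriv (ρ : W l T) : IsTimeDeriv l T (W.val ρ) (W.dt ρ) := ρ.2

theorem W.norm_sq (ρ : W l T) : ‖ρ‖ ^ 2 = ‖W.val ρ‖ ^ 2 + ‖W.dt ρ‖ ^ 2 :=
  WithLp.prod_norm_sq_eq_of_L2 (ρ : WSub l T).1

theorem isTimeDeriv_iff [CompleteSpace (V l)] (hT : 0 < T) (ρ : L2V l T) (σ : L2VStar l T) :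
    IsTimeDeriv l T ρ σ ↔ IsRieszTimeDeriv V.val ρ (rieszLp (V l) T σ) :=
  (isRieszTimeDeriv_rieszLp_iff hT V.val ρ σ).symm

theorem completeSpace_W [CompleteSpace (V l)] (hT : 0 < T) : CompleteSpace (W l T) := by
  suffices h : IsClosed (WSub l T : Set (WithLp 2 (L2V l T × L2VStar l T))) from
    h.completeSpace_coe
  refine isClosed_of_closure_subset fun p hp => ?_
  obtain ⟨q, hq, hqp⟩ := mem_closure_iff_seq_limit.1 hp
  have h1 := ((WithLp.fstL 2 ℝ (L2V l T) (L2VStar l T)).continuous.tendsto p).comp hqp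
  have h2 := ((WithLp.sndL 2 ℝ (L2V l T) (L2VStar l T)).continuous.tendsto p).comp hqp
  have h3 := ((rieszLp (V l) T).continuous.tendsto _).comp h2
  refine (isTimeDeriv_iff hT p.fst p.snd).2 ?_
  exact IsRieszTimeDeriv.of_tendsto hT (fun n => (isTimeDeriv_iff hT _ _).1 (hq n)) h1 h3

theorem W.isRieszTimeDeriv [CompleteSpace (V l)] (hT : 0 < T) (ρ : W l T) :
    IsRieszTimeDeriv V.val (W.val ρ) (rieszLp (V l) T (W.dt ρ)) :=
  (isTimeDeriv_iff hT _ _).1 ρ.isTimeDeriv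

theorem hasInitialValue_iff (ρ : W l T) (h : LL2 l) :
    HasInitialValue ρ h ↔ HasTrace V.val (W.val ρ) h := Iff.rfl

theorem existsUnique_hasInitialValue [CompleteSpace (V l)] (hT : 0 < T) (ρ : W l T) :
    ∃! h : LL2 l, HasInitialValue ρ h := by
  obtain ⟨h, hh⟩ := (ρ.isRieszTimeDeriv hT).exists_hasTrace injective_val hT
  exact ⟨h, hh, fun h' hh' => HasTrace.unique hT hh' hh⟩

theorem initialValue_spec [CompleteSpace (V l)] (hT : 0 < T) (ρ : W l T) :
    HasInitialValue ρ (initialValue ρ) :=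
  Classical.epsilon_spec (p := fun h => HasInitialValue ρ h)
    (existsUnique_hasInitialValue hT ρ).exists

theorem initialValue_eq [CompleteSpace (V l)] (hT : 0 < T) {ρ : W l T} {h : LL2 l}
    (hh : HasInitialValue ρ h) : initialValue ρ = h :=
  HasTrace.unique hT (initialValue_spec hT ρ) hh

theorem exists_initialValue_bound [CompleteSpace (V l)] (hT : 0 < T) :
    ∃ C, ∀ ρ : W l T, ‖initialValue ρ‖ ≤ C * ‖ρ‖ := by
  obtain ⟨C, hC0, hC⟩ := exists_trace_bound (T := T) (V.val : V l →L[ℝ] LL2 l) injective_val hT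
  set K := ‖rieszLp (V l) T‖ with hK
  refine ⟨√(C * (1 + K ^ 2)), fun ρ => le_of_sq_le_sq ?_ (by positivity)⟩
  have h1 := hC _ _ _ (ρ.isRieszTimeDeriv hT) (initialValue_spec hT ρ)
  have h2 := (rieszLp (V l) T).le_opNorm (W.dt ρ)
  have h3 : ‖rieszLp (V l) T (W.dt ρ)‖ ^ 2 ≤ (K * ‖W.dt ρ‖) ^ 2 := by gcongr
  rw [mul_pow, Real.sq_sqrt (by positivity), W.norm_sq, mul_assoc]
  refine h1.trans (mul_le_mul_of_nonneg_left ?_ hC0)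
  nlinarith [mul_nonneg (sq_nonneg K) (sq_nonneg ‖W.val ρ‖), sq_nonneg ‖W.dt ρ‖]

/-- The trace `ρ ↦ ρ(0)` as a bounded linear map `𝕎(0, T) → 𝕃²`. -/
def initialValueL [CompleteSpace (V l)] (hT : 0 < T) : W l T →L[ℝ] LL2 l :=
  LinearMap.mkContinuousOfExistsBound
    { toFun := initialValue
      map_add' := fun ρ ρ' => initialValue_eq hT <| by
        rw [hasInitialValue_iff, map_add]
        exact HasTrace.add (initialValue_spec hT ρ) (initialValue_spec hT ρ')
      map_smul' := fun c ρ => initialValue_eq hT <| by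
        rw [hasInitialValue_iff, map_smul]
        exact HasTrace.smul c (initialValue_spec hT ρ) }
    (exists_initialValue_bound hT)

theorem initialValueL_apply [CompleteSpace (V l)] (hT : 0 < T) (ρ : W l T) :
    initialValueL hT ρ = initialValue ρ := rfl

/-- `ρ ↦ 𝓕[u](ρ, ·)` as a bounded operator `L²(0, T; 𝕍) → L²(0, T; 𝕍*)`. -/
def formL (hl : ∀ i, 0 < l i) (D : Fin N → ℝ) (u : LLinf l T) : L2V l T →L[ℝ] L2VStar l T :=
  LinearMap.mkContinuous
    { toFun := formFunctional l D u
      map_add' := formFunctional_add_right hl D u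
      map_smul' := formFunctional_smul_right hl D u } (∑ i, |D i| + ‖u‖)
    (norm_formFunctional_le hl D u)

theorem formL_apply (hl : ∀ i, 0 < l i) (D : Fin N → ℝ) (u : LLinf l T) (ρ : L2V l T) :
    formL hl D u ρ = formFunctional l D u ρ := rfl

/-- The drift part of `𝓕[u](ρ, ·)`, bilinear in `(u, ρ)`. -/
def driftL (hl : ∀ i, 0 < l i) (T : ℝ) : LLinf l T →L[ℝ] L2V l T →L[ℝ] L2VStar l T :=
  LinearMap.mkContinuous
    { toFun := formL hl 0
      map_add' := fun u u' => by
        ext1 ρ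
        have := formFunctional_add_left hl 0 0 u u' ρ
        rwa [add_zero] at this
      map_smul' := fun c u => by
        ext1 ρ
        have := formFunctional_smul_left hl 0 c u ρ
        rwa [smul_zero] at this } 1
    fun u => by
      refine ContinuousLinearMap.opNorm_le_bound _ (by positivity) fun ρ => ?_
      simpa [formL_apply] using norm_formFunctional_le hl 0 u ρ

theorem formL_eq (hl : ∀ i, 0 < l i) (D : Fin N → ℝ) (u : LLinf l T) :
    formL hl D u = formL hl D 0 + driftL hl T u := by
  ext1 ρ
  have := formFunctional_add_left hl D 0 0 u ρ
  rwa [add_zero, zero_add] at this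

theorem contDiff_formL (hl : ∀ i, 0 < l i) (D : Fin N → ℝ) :
    ContDiff ℝ ∞ (formL hl D : LLinf l T → L2V l T →L[ℝ] L2VStar l T) := by
  rw [show (formL hl D : LLinf l T → L2V l T →L[ℝ] L2VStar l T)
    = fun u => formL hl D 0 + driftL hl T u from funext (formL_eq hl D)]
  have h := ContinuousLinearMap.contDiff (𝕜 := ℝ) (E := LLinf l T)
    (F := L2V l T →L[ℝ] L2VStar l T) (n := ∞) (driftL hl T)
  exact contDiff_const.add h

/-- The linear operator `ρ ↦ (ρ_t + 𝓕[u](ρ, ·), ρ(0))`. -/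
def stateOp [CompleteSpace (V l)] (hl : ∀ i, 0 < l i) (hT : 0 < T) (D : Fin N → ℝ)
    (u : LLinf l T) : W l T →L[ℝ] L2VStar l T × LL2 l :=
  (W.dt + (formL hl D u).comp W.val).prod (initialValueL hT)

theorem contDiff_stateOp [CompleteSpace (V l)] (hl : ∀ i, 0 < l i) (hT : 0 < T) (D : Fin N → ℝ) :
    ContDiff ℝ ∞ (stateOp hl hT D) := by
  have e : stateOp hl hT D = fun u => (ContinuousLinearMap.inl ℝ (L2VStar l T) (LL2 l)).comp
      ((W.dt : W l T →L[ℝ] L2VStar l T) + (formL hl D u).comp W.val)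
      + (ContinuousLinearMap.inr ℝ (L2VStar l T) (LL2 l)).comp (initialValueL hT) := by
    funext u
    ext1 ρ
    simp [stateOp]
  rw [e]
  exact (contDiff_const.clm_comp (contDiff_const.add
    ((contDiff_formL hl D).clm_comp contDiff_const))).add contDiff_const

theorem stateMap_eq [CompleteSpace (V l)] (hl : ∀ i, 0 < l i) (hT : 0 < T) (D : Fin N → ℝ)
    (ρ0 : LL2 l) (p : W l T × LLinf l T) :
    stateMap l D T ρ0 p = stateOp hl hT D p.2 p.1 - (0, ρ0) := by
  simp [stateMap, stateOp, formL_apply, initialValueL_apply]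

theorem contDiff_stateMap [CompleteSpace (V l)] (hl : ∀ i, 0 < l i) (hT : 0 < T) (D : Fin N → ℝ)
    (ρ0 : LL2 l) : ContDiff ℝ ∞ (stateMap l D T ρ0) := by
  rw [show stateMap l D T ρ0 = fun p => stateOp hl hT D p.2 p.1 - (0, ρ0) from
    funext (stateMap_eq hl hT D ρ0)]
  exact (((contDiff_stateOp hl hT D).comp contDiff_snd).clm_apply contDiff_fst).sub contDiff_const

theorem exists_isGarding [CompleteSpace (V l)] (hl : ∀ i, 0 < l i) (D : Fin N → ℝ)
    (hD : ∀ i, 0 < D i) (u : LLinf l T) : ∃ α β : ℝ, 0 < α ∧ 0 ≤ β ∧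
      IsGarding (V.val : V l →L[ℝ] LL2 l) ((rieszLp (V l) T).comp (formL hl D u)) α β := by
  obtain ⟨α, β, hα, hβ, h⟩ := exists_garding D hD u
  refine ⟨α, β, hα, hβ, fun ρ => ?_⟩
  filter_upwards [coeFn_rieszLp (formL hl D u ρ), formFunctional_ae hl D u ρ] with t h1 h2
  rw [ContinuousLinearMap.comp_apply, h1, inner_rieszInv, formL_apply, h2]
  exact h t (ρ t)

/-- Maximal regularity: the state operator is bijective. -/
theorem bijective_stateOp [CompleteSpace (V l)] (hl : ∀ i, 0 < l i) (hT : 0 < T) (D : Fin N → ℝ)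
    (hD : ∀ i, 0 < D i) (u : LLinf l T) : Function.Bijective (stateOp hl hT D u) := by
  obtain ⟨α, β, hα, hβ, hA⟩ := exists_isGarding hl D hD u
  constructor
  · rw [injective_iff_map_eq_zero]
    intro ρ hρ
    obtain ⟨C, hC0, hC⟩ := exists_apriori_bound V.val injective_val hT hα hβ hA
    have h1 : W.dt ρ + formL hl D u (W.val ρ) = 0 := congrArg Prod.fst hρ
    have h2 : initialValue ρ = 0 := congrArg Prod.snd hρ
    have h3 := hC _ _ _ (ρ.isRieszTimeDeriv hT) (initialValue_spec hT ρ)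
    rw [ContinuousLinearMap.comp_apply, ← map_add, h1, h2, map_zero, norm_zero, norm_zero] at h3
    have h4 : W.val ρ = 0 := by
      have : ‖W.val ρ‖ ^ 2 = 0 := le_antisymm (by simpa using h3) (sq_nonneg _)
      simpa using this
    rw [h4, map_zero, add_zero] at h1
    have h5 := ρ.norm_sq
    rw [h4, h1] at h5
    simpa using h5
  · rintro ⟨f, h⟩
    obtain ⟨ρ, s, hd, ht, hf⟩ := exists_parabolic_solution V.val injective_val (denseRange_val hl)
      hT hα hβ hA (rieszLp (V l) T f) h
    obtain ⟨σ, rfl⟩ := rieszLp_surjective s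
    let w : W l T := ⟨WithLp.toLp 2 (ρ, σ), (isTimeDeriv_iff hT ρ σ).2 hd⟩
    refine ⟨w, Prod.ext ?_ ?_⟩
    · rw [ContinuousLinearMap.comp_apply, ← map_add] at hf
      exact rieszLp_injective hf
    · exact initialValue_eq hT ht

theorem isWeakSolution_iff [CompleteSpace (V l)] (hl : ∀ i, 0 < l i) (hT : 0 < T) (D : Fin N → ℝ)
    (ρ0 : LL2 l) (u : LLinf l T) (ρ : W l T) :
    IsWeakSolution l D T ρ0 u ρ ↔ stateOp hl hT D u ρ = (0, ρ0) := by
  set f := formFunctional l D u (W.val ρ) with hf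
  have hform : ∀ (θ : ℝ → ℝ) (φ : V l), ∫ t in Ioo 0 T, θ t * form l D u t (W.val ρ t) φ
      = ∫ t in Ioo 0 T, θ t * f t φ := fun θ φ => by
    refine integral_congr_ae ?_
    filter_upwards [formFunctional_spec hl D u (W.val ρ)] with t ht
    rw [ht]
  have hint : ∀ (σ : L2VStar l T) {θ : ℝ → ℝ}, IsTest 0 T θ →
      Integrable (fun t => θ t • σ t) (edge T) := fun σ θ hθ => integrable_smul_lp (hθ.memLp _) σ
  have happ : ∀ (σ : L2VStar l T) {θ : ℝ → ℝ}, IsTest 0 T θ → ∀ φ,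
      (∫ t in Ioo 0 T, θ t • σ t) φ = ∫ t in Ioo 0 T, θ t * σ t φ := fun σ θ hθ φ =>
    ContinuousLinearMap.integral_apply (hint σ hθ) φ
  have hsum : ∀ {θ : ℝ → ℝ}, IsTest 0 T θ → ∫ t in Ioo 0 T, θ t • (W.dt ρ + f) t
      = (∫ t in Ioo 0 T, θ t • W.dt ρ t) + ∫ t in Ioo 0 T, θ t • f t := fun {θ} hθ => by
    rw [← integral_add (hint _ hθ) (hint _ hθ)]
    refine integral_congr_ae ?_
    filter_upwards [Lp.coeFn_add (W.dt ρ) f] with t ht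
    rw [ht, Pi.add_apply, smul_add]
  have hweak : (∀ φ : V l, ∀ θ : ℝ → ℝ, IsTest 0 T θ →
      -(∫ t in Ioo 0 T, deriv θ t * inner ℝ (V.val (W.val ρ t)) (V.val φ))
        + ∫ t in Ioo 0 T, θ t * form l D u t (W.val ρ t) φ = 0) ↔ W.dt ρ + f = 0 := by
    constructor
    · intro h
      rw [Lp.eq_zero_iff_ae_eq_zero]
      refine ae_eq_zero_of_forall_isTest (lp_integrable _) fun θ hθ => ?_
      ext φ
      have h1 := h φ θ hθ
      rw [ρ.isTimeDeriv θ hθ φ, neg_neg, hform, ← happ _ hθ, ← happ _ hθ] at h1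
      rw [hsum hθ]
      exact h1
    · intro h φ θ hθ
      rw [ρ.isTimeDeriv θ hθ φ, neg_neg, hform, ← happ _ hθ, ← happ _ hθ, ← add_apply, ← hsum hθ, h]
      have : ∫ t in Ioo 0 T, θ t • (0 : L2VStar l T) t = 0 := by
        refine (integral_congr_ae ?_).trans (integral_zero ℝ _)
        filter_upwards [Lp.coeFn_zero (VStar l) 2 (edge T)] with t ht
        rw [ht, Pi.zero_apply, smul_zero]
      rw [this, zero_apply]
  rw [IsWeakSolution, hweak, Prod.ext_iff]
  refine and_congr Iff.rfl ?_
  constructor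
  · exact fun h => initialValue_eq hT h
  · rintro rfl
    exact initialValue_spec hT ρ

end State

end StarGraph

end

theorem lemma4p3 {N : ℕ} (l D : Fin N → ℝ) (T : ℝ) (hl : ∀ i, 0 < l i) (hD : ∀ i, 0 < D i)
    (hT : 0 < T) (ρ0 : StarGraph.LL2 l) :
    -- the map `𝒢` is well defined
    (∀ ρ : StarGraph.W l T, ∃! h : StarGraph.LL2 l, StarGraph.HasInitialValue ρ h) ∧
    (∀ (u : StarGraph.LLinf l T) (ρ : StarGraph.L2V l T),
      ∃! f : StarGraph.L2VStar l T, StarGraph.IsFormFunctional l D u ρ f) ∧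
    -- `𝒢` is smooth
    ContDiff ℝ ∞ (StarGraph.stateMap l D T ρ0) ∧
    -- the control-to-state map `G` is well defined
    (∀ u : StarGraph.LLinf l T, ∃! ρ : StarGraph.W l T, StarGraph.IsWeakSolution l D T ρ0 u ρ) ∧
    -- `G` is smooth
    ContDiff ℝ ∞ (StarGraph.controlToState l D T ρ0) := by
  have := StarGraph.completeSpace_V hl
  have := StarGraph.completeSpace_W (l := l) hT
  have hex : ∀ u : StarGraph.LLinf l T,
      ∃! ρ : StarGraph.W l T, StarGraph.IsWeakSolution l D T ρ0 u ρ := fun u => by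
    simp only [StarGraph.isWeakSolution_iff hl hT]
    exact (StarGraph.bijective_stateOp hl hT D hD u).existsUnique (0, ρ0)
  refine ⟨StarGraph.existsUnique_hasInitialValue hT,
    StarGraph.existsUnique_isFormFunctional hl D, StarGraph.contDiff_stateMap hl hT D ρ0, hex, ?_⟩
  refine StarGraph.contDiff_of_bijective (z := (0, ρ0)) (StarGraph.contDiff_stateOp hl hT D)
    (StarGraph.bijective_stateOp hl hT D hD) fun u => ?_
  exact (StarGraph.isWeakSolution_iff hl hT D ρ0 u _).1
    (Classical.epsilon_spec (p := fun ρ => StarGraph.IsWeakSolution l D T ρ0 u ρ) (hex u).exists)
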